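/- **Setting.** Let $\Bbbk$ be $\mathbb{R}$ or $\mathbb{C}$. An *aromatic forest* is an isomorphism class of finite directed graphs (self-loops allowed, the empty graph $\mathbf 1$ included) in which every node has at most one outgoing edge; a *root* is a node without outgoing edge. Let $\mathcal{AF}$ be the set of aromatic forests, $\mathcal{AT}$ those with exactly one root, $\mathcal A$ those without roots, and $\mathcal F$ those without directed cycles. For $\phi\in\mathcal{AF}$ let $|\phi|$ be its number of nodes, $\sigma(\phi)$ the number of its graph automorphisms, and let concatenation $\phi\psi$ be the disjoint union. Let $H_{\mathcal F}$ be the free vector space on $\mathcal F$ with the concatenation product, $C_{\mathcal A}$ the free vector space on $\mathcal A$, and let $C_{\mathcal A}^*$ be its dual with the product $a\cdot b$ determined by $$\sum_{\gamma\in\mathcal A}\frac{(a\cdot b)(\gamma)}{\sigma(\gamma)}\gamma=\Big(\sum_{\gamma_1\in\mathcal A}\frac{a(\gamma_1)}{\sigma(\gamma_1)}\gamma_1\Big)\Big(\sum_{\gamma_2\in\mathcal A}\frac{b(\gamma_2)}{\sigma(\gamma_2)}\gamma_2\Big)$$ (formal multiplication of series) and the unit $\epsilon_{\mathcal A}$ given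 by $\epsilon_{\mathcal A}(\mathbf 1)=1$ and $\epsilon_{\mathcal A}(\gamma)=0$ for $\gamma\ne\mathbf 1$. A map $b:\mathcal{AF}\to\Bbbk$ induces the linear map $b':H_{\mathcal F}\to C_{\mathcal A}^*$, $\langle b'(\phi),\gamma\rangle=b(\gamma\phi)$ for $\phi\in\mathcal F$, $\gamma\in\mathcal A$. For smooth maps $f:\Bbbk^d\to\Bbbk^d$ and $G$ on $\Bbbk^d$ with values in a normed space over $\Bbbk$ (smooth over $\Bbbk$), put $$F_f(\phi)[G]=\sum_{i:V(\phi)\to\{1,\dots,d\}}\ \prod_{p\in V(\phi)}\Big(\prod_{q:(q,p)\in E(\phi)}\partial_{i_q}\Big)f^{i_p}\ \prod_{s\text{ root}}\partial_{i_s}G ,$$ where each factor indexed by $p$ is the indicated partial derivative of the component $f^{i_p}$. For $\tau\in\mathcal{AT}$, $F_f(\tau)$ is a first-order differential operator and is identified with a vector field. Define the formal power series in $h$ $$B_f(a)(y)=\sum_{\tau\in\mathcal{AT}}h^{|\tau|}\frac{a(\tau)}{\sigma(\tau)}F_f(\tau)(y),\qquad S_f(b)[G](y)=\sum_{\phi\in\mathcal{AF}}h^{|\phi|}\frac{b(\phi)}{\sigma(\phi)}F_f(\phi)[G](y).$$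 **Theorem 4.2.** Let $a:\mathcal{AT}\to\Bbbk$. There is exactly one map $\bar a:\mathcal{AF}\to\Bbbk$ that coincides with $a$ on $\mathcal{AT}$ and whose induced map $\bar a':H_{\mathcal F}\to C_{\mathcal A}^*$ is a morphism of unital algebras. For this $\bar a$, for all $d$, all smooth $f$ and $G$ as above, and all $y\in\Bbbk^d$, $$G\big(y+B_f(a)(y)\big)=S_f(\bar a)[G](y)$$ in the following two senses. (i) It is an identity of formal power series in $h$, where the left side is the formal composition $\sum_{k\ge0}\frac1{k!}G^{(k)}(y)\big(B_f(a)(y),\dots,B_f(a)(y)\big)$. (ii) It is an identity of asymptotic expansions: for every $N\ge 0$ and every $Y:\Bbbk\to\Bbbk^d$ such that, as $h\to0$, $Y(h)$ agrees with the truncation of $y+B_f(a)(y)$ at order $h^N$ up to $O(h^{N+1})$, the value $G(Y(h))$ agrees with the truncation of $S_f(\bar a)[G](y)$ at order $h^N$ up to $O(h^{N+1})$. -/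

import Mathlib

open Filter Topology Asymptotics
open scoped ContDiff

noncomputable section

/-! ### Directed graphs with at most one outgoing edge per node -/

/-- A directed graph on the vertex set `V` (self-loops allowed) in which every node has at most one
outgoing edge: `γ v = some w` means that `(v, w)` is the edge going out of `v`, and `γ v = none`
means that no edge goes out of `v`. -/
abbrev AromaticGraph (V : Type) : Type := V → Option V

namespace AromaticGraph

variable {V W U : Type}

/-- `(v, w)` is an edge of `γ`. -/
def Edge (γ : AromaticGraph V) (v w : V) : Prop := γ v = some w

/-- The bijection `e` maps the edge set of `γ` onto the edge set of `δ`. -/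
def IsIso (γ : AromaticGraph V) (δ : AromaticGraph W) (e : V ≃ W) : Prop :=
  ∀ v w, δ.Edge (e v) (e w) ↔ γ.Edge v w

theorem isIso_refl (γ : AromaticGraph V) : γ.IsIso γ (Equiv.refl V) := fun _ _ => Iff.rfl

theorem IsIso.symm {γ : AromaticGraph V} {δ : AromaticGraph W} {e : V ≃ W} (h : γ.IsIso δ e) :
    δ.IsIso γ e.symm := fun v w => by simpa using (h (e.symm v) (e.symm w)).symm

theorem IsIso.trans {γ : AromaticGraph V} {δ : AromaticGraph W} {ε : AromaticGraph U}
    {e : V ≃ W} {e' : W ≃ U} (h : γ.IsIso δ e) (h' : δ.IsIso ε e') : γ.IsIso ε (e.trans e') :=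
  fun v w => (h' (e v) (e w)).trans (h v w)

/-- The number of graph automorphisms of `γ`. -/
def autCard (γ : AromaticGraph V) : ℕ := Nat.card {e : Equiv.Perm V // γ.IsIso γ e}

/-- `γ` has no directed cycle (a self-loop is a directed cycle). -/
def Loopless (γ : AromaticGraph V) : Prop := ∀ v, ¬ Relation.TransGen γ.Edge v v

theorem IsIso.autCard_eq {γ : AromaticGraph V} {δ : AromaticGraph W} {e : V ≃ W}
    (h : γ.IsIso δ e) : γ.autCard = δ.autCard :=
  Nat.card_congr
    { toFun := fun g => ⟨(e.symm.trans g.1).trans e, (h.symm.trans g.2).trans h⟩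
      invFun := fun g => ⟨(e.trans g.1).trans e.symm, (h.trans g.2).trans h.symm⟩
      left_inv := fun g => by ext; simp
      right_inv := fun g => by ext; simp }

theorem IsIso.loopless {γ : AromaticGraph V} {δ : AromaticGraph W} {e : V ≃ W}
    (h : γ.IsIso δ e) (hδ : δ.Loopless) : γ.Loopless := fun v hv =>
  hδ (e v) (hv.lift e fun a b hab => (h a b).2 hab)

/-- The disjoint union of two graphs. -/
def disjointUnion (γ : AromaticGraph V) (δ : AromaticGraph W) : AromaticGraph (V ⊕ W) :=
  Sum.elim (fun v => (γ v).map Sum.inl) (fun w => (δ w).map Sum.inr)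

/-- Relabelling of the vertices along a bijection. -/
def relabel (e : V ≃ W) (γ : AromaticGraph V) : AromaticGraph W :=
  fun w => (γ (e.symm w)).map e

theorem isIso_relabel (e : V ≃ W) (γ : AromaticGraph V) : γ.IsIso (γ.relabel e) e := by
  intro v w
  simp [Edge, relabel]

theorem IsIso.disjointUnion {V' W' : Type} {γ : AromaticGraph V} {γ' : AromaticGraph V'}
    {δ : AromaticGraph W} {δ' : AromaticGraph W'} {e : V ≃ V'} {e' : W ≃ W'}
    (h : γ.IsIso γ' e) (h' : δ.IsIso δ' e') :
    (γ.disjointUnion δ).IsIso (γ'.disjointUnion δ') (Equiv.sumCongr e e') := by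
  rintro (v | v) (w | w)
  · simpa [Edge, AromaticGraph.disjointUnion] using h v w
  · simp [Edge, AromaticGraph.disjointUnion]
  · simp [Edge, AromaticGraph.disjointUnion]
  · simpa [Edge, AromaticGraph.disjointUnion] using h' v w

theorem Loopless.disjointUnion {γ : AromaticGraph V} {δ : AromaticGraph W}
    (h : γ.Loopless) (h' : δ.Loopless) : (γ.disjointUnion δ).Loopless := by
  have key : ∀ a b, Relation.TransGen (γ.disjointUnion δ).Edge a b →
      (∀ v, a = Sum.inl v → ∃ w, b = Sum.inl w ∧ Relation.TransGen γ.Edge v w) ∧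
      (∀ v, a = Sum.inr v → ∃ w, b = Sum.inr w ∧ Relation.TransGen δ.Edge v w) := by
    intro a b hab
    have step : ∀ x y, (γ.disjointUnion δ).Edge x y →
        (∀ v, x = Sum.inl v → ∃ w, y = Sum.inl w ∧ γ.Edge v w) ∧
        (∀ v, x = Sum.inr v → ∃ w, y = Sum.inr w ∧ δ.Edge v w) := by
      rintro (x | x) (y | y) hxy <;> simp_all [Edge, AromaticGraph.disjointUnion]
    induction hab with
    | single hb =>
      refine ⟨fun v hv => ?_, fun v hv => ?_⟩
      · obtain ⟨w, hw, e⟩ := (step _ _ hb).1 v hv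
        exact ⟨w, hw, .single e⟩
      · obtain ⟨w, hw, e⟩ := (step _ _ hb).2 v hv
        exact ⟨w, hw, .single e⟩
    | tail _ hb ih =>
      refine ⟨fun v hv => ?_, fun v hv => ?_⟩
      · obtain ⟨w, hw, e⟩ := ih.1 v hv
        obtain ⟨w', hw', e'⟩ := (step _ _ hb).1 w hw
        exact ⟨w', hw', e.tail e'⟩
      · obtain ⟨w, hw, e⟩ := ih.2 v hv
        obtain ⟨w', hw', e'⟩ := (step _ _ hb).2 w hw
        exact ⟨w', hw', e.tail e'⟩
  rintro (v | v) hv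
  · obtain ⟨w, hw, e⟩ := (key _ _ hv).1 v rfl
    cases hw
    exact h _ e
  · obtain ⟨w, hw, e⟩ := (key _ _ hv).2 v rfl
    cases hw
    exact h' _ e

variable [Fintype V] [DecidableEq V] [Fintype W] [DecidableEq W]

/-- The roots: the nodes without an outgoing edge. -/
def roots (γ : AromaticGraph V) : Finset V := Finset.univ.filter fun v => γ v = none

/-- The direct predecessors of the node `p`. -/
def predecessors (γ : AromaticGraph V) (p : V) : Finset V :=
  Finset.univ.filter fun q => γ q = some p

theorem mem_roots_iff (γ : AromaticGraph V) (v : V) : v ∈ γ.roots ↔ ∀ w, ¬ γ.Edge v w := by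
  simp [roots, Edge, Option.eq_none_iff_forall_ne_some]

theorem IsIso.roots_eq {γ : AromaticGraph V} {δ : AromaticGraph W} {e : V ≃ W}
    (h : γ.IsIso δ e) : δ.roots = γ.roots.map e.toEmbedding := by
  ext w
  obtain ⟨v, rfl⟩ := e.surjective w
  simp only [Finset.mem_map_equiv, Equiv.symm_apply_apply, mem_roots_iff]
  rw [← e.forall_congr_right]
  simp [h v]

theorem IsIso.predecessors_eq {γ : AromaticGraph V} {δ : AromaticGraph W} {e : V ≃ W}
    (h : γ.IsIso δ e) (p : V) : δ.predecessors (e p) = (γ.predecessors p).map e.toEmbedding := by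
  ext w
  obtain ⟨v, rfl⟩ := e.surjective w
  simpa [predecessors, Finset.mem_map_equiv, Edge] using h v p

end AromaticGraph

/-! ### Aromatic forests -/

/-- Equivalence of graphs with the vertex set `{0, …, n - 1}`. -/
def aromaticSetoid (n : ℕ) : Setoid (AromaticGraph (Fin n)) where
  r γ δ := ∃ e : Fin n ≃ Fin n, γ.IsIso δ e
  iseqv := ⟨fun γ => ⟨_, γ.isIso_refl⟩, fun ⟨_, h⟩ => ⟨_, h.symm⟩,
    fun ⟨_, h⟩ ⟨_, h'⟩ => ⟨_, h.trans h'⟩⟩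

/-- An aromatic forest: an equivalence class of finite directed graphs where each node has at most
one outgoing edge. It consists of its number of nodes and an equivalence class of graphs on
`{0, …, n - 1}`. The empty graph is allowed. -/
def AromaticForest : Type := Σ n : ℕ, Quotient (aromaticSetoid n)

instance (n : ℕ) : Finite (Quotient (aromaticSetoid n)) := Quotient.finite _

instance (n : ℕ) : Fintype (Quotient (aromaticSetoid n)) := Fintype.ofFinite _

namespace AromaticForest

/-- The number of nodes. -/
def size (φ : AromaticForest) : ℕ := φ.1

/-- The class of a graph on `{0, …, n - 1}`. -/
def mk {n : ℕ} (γ : AromaticGraph (Fin n)) : AromaticForest := ⟨n, Quotient.mk _ γ⟩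

/-- The normalization constant: the size of the graph automorphism group. -/
def sigma (φ : AromaticForest) : ℕ :=
  Quotient.lift (s := aromaticSetoid φ.1) (fun γ => γ.autCard)
    (fun _ _ ⟨_, h⟩ => h.autCard_eq) φ.2

/-- The number of roots. -/
def numRoots (φ : AromaticForest) : ℕ :=
  Quotient.lift (s := aromaticSetoid φ.1) (fun γ => γ.roots.card)
    (fun _ _ ⟨_, h⟩ => by simp only [h.roots_eq, Finset.card_map]) φ.2

/-- The forest has no directed cycle. -/
def IsLoopless (φ : AromaticForest) : Prop :=
  Quotient.lift (s := aromaticSetoid φ.1) (fun γ => γ.Loopless)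
    (fun _ _ ⟨_, h⟩ => propext ⟨h.symm.loopless, h.loopless⟩) φ.2

/-- The empty forest. -/
instance : One AromaticForest := ⟨mk (n := 0) Fin.elim0⟩

/-- Concatenation: the disjoint union of the two graphs. -/
instance : Mul AromaticForest :=
  ⟨fun φ ψ => ⟨φ.1 + ψ.1,
    Quotient.map₂ (sa := aromaticSetoid φ.1) (sb := aromaticSetoid ψ.1)
      (sc := aromaticSetoid (φ.1 + ψ.1))
      (fun γ δ => (γ.disjointUnion δ).relabel finSumFinEquiv)
      (fun _ _ ⟨_, h⟩ _ _ ⟨_, h'⟩ =>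
        ⟨_, ((AromaticGraph.isIso_relabel finSumFinEquiv _).symm.trans
          (h.disjointUnion h')).trans (AromaticGraph.isIso_relabel finSumFinEquiv _)⟩)
      φ.2 ψ.2⟩⟩

theorem isLoopless_one : (1 : AromaticForest).IsLoopless := fun v => v.elim0

theorem IsLoopless.mul {φ ψ : AromaticForest} (hφ : φ.IsLoopless) (hψ : ψ.IsLoopless) :
    (φ * ψ).IsLoopless := by
  obtain ⟨m, φ⟩ := φ
  obtain ⟨n, ψ⟩ := ψ
  induction φ using Quotient.inductionOn
  induction ψ using Quotient.inductionOn
  exact (AromaticGraph.isIso_relabel finSumFinEquiv _).symm.loopless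
    (AromaticGraph.Loopless.disjointUnion hφ hψ)

/-- The finite set of all aromatic forests with `n` nodes. -/
def ofSize (n : ℕ) : Finset AromaticForest :=
  (Finset.univ : Finset (Quotient (aromaticSetoid n))).map ⟨Sigma.mk n, sigma_mk_injective⟩

end AromaticForest

/-- The aromatic forests without roots. -/
abbrev RootlessForest : Type := {φ : AromaticForest // φ.numRoots = 0}

/-- The aromatic trees: the aromatic forests with exactly one root. -/
abbrev AromaticTree : Type := {φ : AromaticForest // φ.numRoots = 1}

/-- The (loopless) forests, that is, the multisets of rooted trees. -/
abbrev LooplessForest : Type := {φ : AromaticForest // φ.IsLoopless}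

instance : One LooplessForest := ⟨⟨1, AromaticForest.isLoopless_one⟩⟩

instance : Mul LooplessForest := ⟨fun φ ψ => ⟨φ.1 * ψ.1, φ.2.mul ψ.2⟩⟩

/-! ### The algebra of forests and the dual of the coalgebra of rootless forests -/

section Algebra

variable (𝕜 : Type) [Field 𝕜]

/-- The free vector space over the loopless forests; as a monoid algebra it carries
the concatenation product. -/
abbrev ForestAlgebra : Type := MonoidAlgebra 𝕜 LooplessForest

/-- The linear dual of the free vector space over the rootless forests. -/
abbrev RootlessDual : Type := Module.Dual 𝕜 (RootlessForest →₀ 𝕜)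

variable {𝕜}

/-- The value of a linear form on a rootless forest. -/
def RootlessDual.coeff (a : RootlessDual 𝕜) (γ : RootlessForest) : 𝕜 := a (Finsupp.single γ 1)

open Classical in
/-- The pairs of rootless forests whose concatenation is `γ`. -/
def rootlessFactorizations (γ : RootlessForest) : Finset (RootlessForest × RootlessForest) :=
  ((Finset.HasAntidiagonal.antidiagonal γ.1.size).biUnion fun mn =>
    ((AromaticForest.ofSize mn.1).subtype fun φ => φ.numRoots = 0) ×ˢ
      ((AromaticForest.ofSize mn.2).subtype fun φ => φ.numRoots = 0)).filter
    fun p => p.1.1 * p.2.1 = γ.1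

theorem mem_rootlessFactorizations (γ : RootlessForest) (p : RootlessForest × RootlessForest) :
    p ∈ rootlessFactorizations γ ↔ p.1.1 * p.2.1 = γ.1 := by
  have hmem : ∀ φ : AromaticForest, φ ∈ AromaticForest.ofSize φ.size := fun φ => by
    simp only [AromaticForest.ofSize, Finset.mem_map, Finset.mem_univ, true_and]
    exact ⟨φ.2, rfl⟩
  simp only [rootlessFactorizations, Finset.mem_filter, Finset.mem_biUnion, Finset.mem_product,
    Finset.mem_subtype, Finset.HasAntidiagonal.mem_antidiagonal, and_iff_right_iff_imp]
  intro h
  refine ⟨(p.1.1.size, p.2.1.size), ?_, hmem _, hmem _⟩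
  rw [← h]
  rfl

/-- The product on the dual of the coalgebra of rootless forests: `a · b` is determined by
`∑ (a · b)(γ) / σ(γ) γ = (∑ a(γ₁) / σ(γ₁) γ₁) (∑ b(γ₂) / σ(γ₂) γ₂)`,
with formal multiplication of series on the right. -/
def RootlessDual.mul (a b : RootlessDual 𝕜) : RootlessDual 𝕜 :=
  Finsupp.linearCombination 𝕜 fun γ : RootlessForest =>
    (γ.1.sigma : 𝕜) * ∑ p ∈ rootlessFactorizations γ,
      (a.coeff p.1 / (p.1.1.sigma : 𝕜)) * (b.coeff p.2 / (p.2.1.sigma : 𝕜))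

open Classical in
/-- The unit of the dual of the coalgebra of rootless forests: the counit, which maps the empty
forest to `1` and every other rootless forest to `0`. -/
def RootlessDual.one : RootlessDual 𝕜 :=
  Finsupp.linearCombination 𝕜 fun γ : RootlessForest => if γ.1 = 1 then (1 : 𝕜) else 0

/-- The linear map from the algebra of forests to the dual of the coalgebra of rootless forests
induced by a series `a` over the aromatic forests: `⟨a'(φ), γ⟩ = a(γ φ)`. -/
def inducedMap (a : AromaticForest → 𝕜) : ForestAlgebra 𝕜 →ₗ[𝕜] RootlessDual 𝕜 :=
  (Finsupp.linearCombination 𝕜 fun φ : LooplessForest =>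
    (Finsupp.linearCombination 𝕜 fun γ : RootlessForest => a (γ.1 * φ.1) :
      RootlessDual 𝕜)) ∘ₗ (MonoidAlgebra.coeffLinearEquiv 𝕜).toLinearMap

/-- A linear map from the algebra of forests to the dual of the coalgebra of rootless forests is
a morphism of (unital) algebras. -/
structure IsAlgebraMorphism (L : ForestAlgebra 𝕜 →ₗ[𝕜] RootlessDual 𝕜) : Prop where
  map_one : L 1 = RootlessDual.one
  map_mul : ∀ x y, L (x * y) = (L x).mul (L y)

/-- `b` coincides with `a` on the aromatic trees, and the linear map induced by `b` is an algebra
morphism. -/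
structure IsMultiplicativeExtension (a : AromaticTree → 𝕜) (b : AromaticForest → 𝕜) : Prop where
  eq_on_trees : ∀ τ : AromaticTree, b τ.1 = a τ
  isAlgebraMorphism : IsAlgebraMorphism (inducedMap b)

end Algebra

/-! ### Elemental differential operators -/

section Analysis

variable {𝕜 : Type} [RCLike 𝕜] {d : ℕ} {W : Type*} [NormedAddCommGroup W] [NormedSpace 𝕜 W]

/-- The partial derivative `∂^I H` at `y`, where the multiindex `I` is given as the multiset of the
coordinate directions. -/
def multiPartial (I : Multiset (Fin d)) (H : (Fin d → 𝕜) → W) (y : Fin d → 𝕜) : W :=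
  iteratedFDeriv 𝕜 I.sort.length H y fun j => Pi.single (I.sort.get j) 1

/-- The elemental differential operator of a graph, applied to `G` at `y`: the sum over all
assignments `i` of coordinate indices to the nodes of
`(∏ p, f^{i_p}_{I_{π(p)}}) ∏ s root, ∂_{i_s} G`. -/
def AromaticGraph.elementalOp {V : Type} [Fintype V] [DecidableEq V] (γ : AromaticGraph V)
    (f : (Fin d → 𝕜) → (Fin d → 𝕜)) (G : (Fin d → 𝕜) → W) (y : Fin d → 𝕜) : W :=
  ∑ i : V → Fin d,
    (∏ p : V, multiPartial ((γ.predecessors p).val.map i) (fun x => f x (i p)) y) •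
      multiPartial (γ.roots.val.map i) G y

theorem AromaticGraph.IsIso.elementalOp_eq {V V' : Type} [Fintype V] [DecidableEq V] [Fintype V']
    [DecidableEq V'] {γ : AromaticGraph V} {δ : AromaticGraph V'} {e : V ≃ V'} (h : γ.IsIso δ e)
    (f : (Fin d → 𝕜) → (Fin d → 𝕜)) (G : (Fin d → 𝕜) → W) (y : Fin d → 𝕜) :
    γ.elementalOp f G y = δ.elementalOp f G y := by
  unfold AromaticGraph.elementalOp
  refine Fintype.sum_equiv (Equiv.arrowCongr e (Equiv.refl _)) _ _ fun i => ?_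
  congr 1
  · refine Fintype.prod_equiv e _ _ fun p => ?_
    simp [h.predecessors_eq, Multiset.map_map, Function.comp_def]
  · simp [h.roots_eq, Multiset.map_map, Function.comp_def]

namespace AromaticForest

/-- The elemental differential operator `F_f(φ)`, applied to `G` at `y`. -/
def elementalOp (φ : AromaticForest) (f : (Fin d → 𝕜) → (Fin d → 𝕜)) (G : (Fin d → 𝕜) → W)
    (y : Fin d → 𝕜) : W :=
  Quotient.lift (s := aromaticSetoid φ.1) (fun γ => γ.elementalOp f G y)
    (fun _ _ ⟨_, h⟩ => h.elementalOp_eq f G y) φ.2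

end AromaticForest

/-- The elemental vector field of an aromatic tree: the vector field whose components are obtained
by applying the first-order differential operator `F_f(τ)` to the coordinate functions. -/
def elementalField (τ : AromaticTree) (f : (Fin d → 𝕜) → (Fin d → 𝕜))
    (y : Fin d → 𝕜) : Fin d → 𝕜 :=
  fun c => τ.1.elementalOp f (fun x => x c) y

/-! ### Aromatic B-series and S-series as formal power series in the step size -/

/-- The coefficient of `h ^ n` in the aromatic B-series
`B_f(a)(y) = ∑ τ, h ^ |τ| * a(τ) / σ(τ) * F_f(τ)(y)`. -/
def bSeries (f : (Fin d → 𝕜) → (Fin d → 𝕜)) (a : AromaticTree → 𝕜) (y : Fin d → 𝕜) (n : ℕ) :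
    Fin d → 𝕜 :=
  ∑ τ ∈ (AromaticForest.ofSize n).subtype fun φ => φ.numRoots = 1,
    (a τ / (τ.1.sigma : 𝕜)) • elementalField τ f y

/-- The coefficient of `h ^ n` in the aromatic S-series
`S_f(b)[G](y) = ∑ φ, h ^ |φ| * b(φ) / σ(φ) * F_f(φ)[G](y)`. -/
def sSeries (f : (Fin d → 𝕜) → (Fin d → 𝕜)) (b : AromaticForest → 𝕜) (G : (Fin d → 𝕜) → W)
    (y : Fin d → 𝕜) (n : ℕ) : W :=
  ∑ φ ∈ AromaticForest.ofSize n, (b φ / (φ.sigma : 𝕜)) • φ.elementalOp f G y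

/-- The formal power series `y + B_f(a)(y)`. -/
def shiftedBSeries (f : (Fin d → 𝕜) → (Fin d → 𝕜)) (a : AromaticTree → 𝕜) (y : Fin d → 𝕜) (n : ℕ) :
    Fin d → 𝕜 :=
  (if n = 0 then y else 0) + bSeries f a y n

variable (𝕜) in
/-- The coefficient of `h ^ n` in the formal power series `G(Y)`, where `Y = ∑ h ^ m Y_m` is a
formal power series: with `R = Y - Y_0`, this is the coefficient of `h ^ n` in the Taylor series
`∑ k, 1 / k! * G^(k)(Y_0)(R, …, R)`. As `R` has no constant term, only `k ≤ n` contribute. -/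
def formalComp (G : (Fin d → 𝕜) → W) (Y : ℕ → Fin d → 𝕜) (n : ℕ) : W :=
  ∑ k ∈ Finset.range (n + 1), ((k.factorial : 𝕜)⁻¹) •
    ∑ m ∈ (Finset.Nat.antidiagonalTuple k n).filter (fun m => ∀ j, m j ≠ 0),
      iteratedFDeriv 𝕜 k G (Y 0) fun j => Y (m j)

variable (𝕜) in
/-- `u h` has the asymptotic expansion `∑ h ^ n c_n` as `h → 0` up to order `N`, that is, with
an error `O(h ^ (N + 1))`. -/
def HasExpansionUpTo {X : Type*} [NormedAddCommGroup X] [NormedSpace 𝕜 X] (u : 𝕜 → X) (c : ℕ → X)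
    (N : ℕ) : Prop :=
  (fun h : 𝕜 => u h - ∑ n ∈ Finset.range (N + 1), h ^ n • c n) =O[𝓝 0] fun h : 𝕜 => h ^ (N + 1)

end Analysis

end

noncomputable section

/-!
Every aromatic forest is the product of its rootless core and of the aromatic trees spanned by its
roots, so multiplicativity of `b'` determines `b` from its values on aromatic trees. To compare `b`
with the powers of `a`, count the ways to split off the component of one root from a labelled
graph: with the concatenation product of formal series, `numRoots · b/σ = (a/σ) * (b/σ)`, which says
that `b/σ` is the exponential of `a/σ`. Concatenation with an aromatic tree acts on elemental
differential operators as a directional derivative along the elemental field of the tree, so the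
part of `S_f(b)[G]` coming from forests with `k` roots is `G^(k)(B, …, B) / k!` with `B = B_f(a)`.
Summing over `k` gives the formal identity, and Taylor's theorem turns it into the asymptotic one.
-/

namespace AromaticGraph

variable {V W : Type}

theorem edge_disjointUnion {γ : AromaticGraph V} {δ : AromaticGraph W} {x y : V ⊕ W} :
    (γ.disjointUnion δ).Edge x y ↔ Sum.LiftRel γ.Edge δ.Edge x y := by
  rcases x with v | v <;> rcases y with w | w <;> simp [Edge, disjointUnion]

theorem roots_disjointUnion [Fintype V] [Fintype W] (γ : AromaticGraph V) (δ : AromaticGraph W) :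
    (γ.disjointUnion δ).roots = γ.roots.disjSum δ.roots := by
  classical
  ext (v | v) <;> simp [mem_roots_iff, edge_disjointUnion]

open Classical in
/-- The subgraph induced on the set `S` of vertices. -/
def restrict (γ : AromaticGraph V) (S : Set V) : AromaticGraph S :=
  fun v => (γ v).bind fun w => if h : w ∈ S then some ⟨w, h⟩ else none

theorem edge_restrict {γ : AromaticGraph V} {S : Set V} {v w : S} :
    (γ.restrict S).Edge v w ↔ γ.Edge v w := by
  simp [Edge, restrict, Option.bind_eq_some_iff, Subtype.ext_iff]

/-- The vertex set `S` is a union of connected components. -/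
def IsSaturated (γ : AromaticGraph V) (S : Set V) : Prop :=
  ∀ v w, γ.Edge v w → (v ∈ S ↔ w ∈ S)

namespace IsSaturated

variable {γ : AromaticGraph V} {S T : Set V}

theorem compl (h : γ.IsSaturated S) : γ.IsSaturated Sᶜ :=
  fun v w e => not_congr (h v w e)

theorem union (hS : γ.IsSaturated S) (hT : γ.IsSaturated T) : γ.IsSaturated (S ∪ T) :=
  fun v w e => or_congr (hS v w e) (hT v w e)

theorem restrict_eq_none (h : γ.IsSaturated S) (v : S) : γ.restrict S v = none ↔ γ v = none := by
  simp only [Option.eq_none_iff_forall_ne_some]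
  exact ⟨fun hv w hw => hv ⟨w, (h v w hw).1 v.2⟩ (edge_restrict.2 hw),
    fun hv w hw => hv w (edge_restrict.1 hw)⟩

theorem isIso_union [DecidablePred (· ∈ S)] (hS : γ.IsSaturated S) (hST : Disjoint S T) :
    ((γ.restrict S).disjointUnion (γ.restrict T)).IsIso (γ.restrict (S ∪ T))
      (Equiv.Set.union hST).symm := by
  have hTS : ∀ w : T, (w : V) ∉ S := fun w => Set.disjoint_right.1 hST w.2
  rintro (v | v) (w | w) <;> simp only [edge_disjointUnion, edge_restrict,
    Equiv.Set.union_symm_apply_left, Equiv.Set.union_symm_apply_right, Sum.liftRel_inl_inl,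
    Sum.liftRel_inr_inr, Sum.not_liftRel_inl_inr, Sum.not_liftRel_inr_inl, iff_false]
  · exact fun e => hTS w ((hS _ _ e).1 v.2)
  · exact fun e => hTS v ((hS _ _ e).2 w.2)

theorem isIso_sumCompl [DecidablePred (· ∈ S)] (h : γ.IsSaturated S) :
    ((γ.restrict S).disjointUnion (γ.restrict Sᶜ)).IsIso γ (Equiv.Set.sumCompl S) := by
  rintro (v | v) (w | w) <;> simp only [edge_disjointUnion, edge_restrict,
    Equiv.Set.sumCompl_apply_inl, Equiv.Set.sumCompl_apply_inr, Sum.liftRel_inl_inl,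
    Sum.liftRel_inr_inr, Sum.not_liftRel_inl_inr, Sum.not_liftRel_inr_inl, iff_false]
  · exact fun e => w.2 ((h _ _ e).1 v.2)
  · exact fun e => v.2 ((h _ _ e).2 w.2)

end IsSaturated

theorem isIso_image {γ : AromaticGraph V} {δ : AromaticGraph W} {g : V → W}
    (hg : Function.Injective g) (h : ∀ v w, δ.Edge (g v) (g w) ↔ γ.Edge v w) (S : Set V) :
    (γ.restrict S).IsIso (δ.restrict (g '' S)) (Equiv.Set.image g S hg) := fun v w => by
  simp [edge_restrict, h]

theorem isIso_ofInjective {γ : AromaticGraph V} {δ : AromaticGraph W} {g : W → V}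
    (hg : Function.Injective g) (h : ∀ v w, γ.Edge (g v) (g w) ↔ δ.Edge v w) :
    δ.IsIso (γ.restrict (Set.range g)) (Equiv.ofInjective g hg) := fun v w => by
  simp [edge_restrict, h]

end AromaticGraph

namespace AromaticForest

open AromaticGraph

variable {V W : Type} [Finite V] [Finite W]

/-- The isomorphism class of a finite graph. -/
def of (γ : AromaticGraph V) : AromaticForest := mk (γ.relabel (Finite.equivFin V))

theorem mk_eq_mk_iff {m n : ℕ} {γ : AromaticGraph (Fin m)} {δ : AromaticGraph (Fin n)} :
    mk γ = mk δ ↔ ∃ e : Fin m ≃ Fin n, γ.IsIso δ e := by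
  constructor
  · intro h
    obtain rfl : m = n := congrArg Sigma.fst h
    exact Quotient.exact (s := aromaticSetoid m) (eq_of_heq (Sigma.mk.inj h).2)
  · rintro ⟨e, he⟩
    obtain rfl : m = n := by simpa using Fintype.card_congr e
    exact congrArg (Sigma.mk m) (Quotient.sound (s := aromaticSetoid m) ⟨e, he⟩)

theorem of_eq_of_iff {γ : AromaticGraph V} {δ : AromaticGraph W} :
    of γ = of δ ↔ ∃ e : V ≃ W, γ.IsIso δ e := by
  rw [of, of, mk_eq_mk_iff]
  constructor
  · rintro ⟨e, he⟩
    exact ⟨_, ((isIso_relabel _ γ).trans he).trans (isIso_relabel _ δ).symm⟩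
  · rintro ⟨e, he⟩
    exact ⟨_, ((isIso_relabel _ γ).symm.trans he).trans (isIso_relabel _ δ)⟩

theorem of_congr {γ : AromaticGraph V} {δ : AromaticGraph W} {e : V ≃ W} (h : γ.IsIso δ e) :
    of γ = of δ := of_eq_of_iff.2 ⟨e, h⟩

theorem of_eq_mk {n : ℕ} (γ : AromaticGraph (Fin n)) : of γ = mk γ :=
  mk_eq_mk_iff.2 ⟨_, (isIso_relabel _ γ).symm⟩

theorem exists_of (φ : AromaticForest) : ∃ (n : ℕ) (γ : AromaticGraph (Fin n)), of γ = φ := by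
  obtain ⟨n, q⟩ := φ
  obtain ⟨γ, rfl⟩ := q.exists_rep
  exact ⟨n, γ, of_eq_mk γ⟩

theorem of_mul_of (γ : AromaticGraph V) (δ : AromaticGraph W) :
    of γ * of δ = of (γ.disjointUnion δ) := by
  have h : of γ * of δ = mk (((γ.relabel (Finite.equivFin V)).disjointUnion
      (δ.relabel (Finite.equivFin W))).relabel finSumFinEquiv) := rfl
  rw [h, ← of_eq_mk]
  exact of_congr (((isIso_relabel _ γ).disjointUnion (isIso_relabel _ δ)).trans
    (isIso_relabel finSumFinEquiv _)).symm

theorem of_eq_one [IsEmpty V] (γ : AromaticGraph V) : of γ = 1 := by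
  have h : (1 : AromaticForest) = of (Fin.elim0 : AromaticGraph (Fin 0)) := (of_eq_mk _).symm
  rw [h]
  exact of_congr (e := Equiv.equivOfIsEmpty _ _) fun v => isEmptyElim v

instance : CommMonoid AromaticForest where
  mul_assoc φ ψ χ := by
    obtain ⟨⟨_, γ, rfl⟩, ⟨_, δ, rfl⟩, ⟨_, ε, rfl⟩⟩ := φ.exists_of, ψ.exists_of, χ.exists_of
    simp only [of_mul_of]
    refine of_congr (e := Equiv.sumAssoc _ _ _) ?_
    rintro ((v | v) | v) ((w | w) | w) <;> simp [edge_disjointUnion]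
  mul_comm φ ψ := by
    obtain ⟨⟨_, γ, rfl⟩, ⟨_, δ, rfl⟩⟩ := φ.exists_of, ψ.exists_of
    simp only [of_mul_of]
    refine of_congr (e := Equiv.sumComm _ _) ?_
    rintro (v | v) (w | w) <;> simp [edge_disjointUnion]
  one_mul φ := by
    obtain ⟨_, γ, rfl⟩ := φ.exists_of
    rw [← of_eq_one (Empty.elim : AromaticGraph Empty), of_mul_of]
    refine of_congr (e := Equiv.emptySum _ _) ?_
    rintro (⟨⟨⟩⟩ | v) (⟨⟨⟩⟩ | w)
    simp [edge_disjointUnion]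
  mul_one φ := by
    obtain ⟨_, γ, rfl⟩ := φ.exists_of
    rw [← of_eq_one (Empty.elim : AromaticGraph Empty), of_mul_of]
    refine of_congr (e := Equiv.sumEmpty _ _) ?_
    rintro (v | ⟨⟨⟩⟩) (w | ⟨⟨⟩⟩)
    simp [edge_disjointUnion]

theorem size_of (γ : AromaticGraph V) : (of γ).size = Nat.card V := rfl

theorem size_mul (φ ψ : AromaticForest) : (φ * ψ).size = φ.size + ψ.size := rfl

theorem mem_ofSize {φ : AromaticForest} {n : ℕ} : φ ∈ ofSize n ↔ φ.size = n := by
  simp only [ofSize, Finset.mem_map, Finset.mem_univ, true_and]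
  constructor
  · rintro ⟨q, rfl⟩
    rfl
  · rintro rfl
    exact ⟨φ.2, rfl⟩

theorem sigma_of (γ : AromaticGraph V) : (of γ).sigma = γ.autCard :=
  (isIso_relabel _ γ).autCard_eq.symm

theorem sigma_pos (φ : AromaticForest) : 0 < φ.sigma := by
  obtain ⟨_, γ, rfl⟩ := φ.exists_of
  rw [sigma_of, autCard]
  have : Nonempty {e : Equiv.Perm _ // γ.IsIso γ e} := ⟨⟨_, γ.isIso_refl⟩⟩
  exact Nat.card_pos

theorem sigma_one : (1 : AromaticForest).sigma = 1 := by
  rw [← of_eq_one (Empty.elim : AromaticGraph Empty), sigma_of, autCard]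
  exact Nat.card_eq_one_iff_unique.2 ⟨inferInstance, ⟨⟨1, isIso_refl _⟩⟩⟩

theorem isLoopless_of (γ : AromaticGraph V) : (of γ).IsLoopless ↔ γ.Loopless :=
  ⟨(isIso_relabel _ γ).loopless, (isIso_relabel _ γ).symm.loopless⟩

theorem numRoots_of [Fintype V] (γ : AromaticGraph V) : (of γ).numRoots = γ.roots.card := by
  classical
  have h : (of γ).numRoots = (γ.relabel (Finite.equivFin V)).roots.card := rfl
  rw [h, (isIso_relabel _ γ).roots_eq, Finset.card_map]

theorem numRoots_mul (φ ψ : AromaticForest) : (φ * ψ).numRoots = φ.numRoots + ψ.numRoots := by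
  obtain ⟨⟨_, γ, rfl⟩, ⟨_, δ, rfl⟩⟩ := φ.exists_of, ψ.exists_of
  rw [of_mul_of, numRoots_of, numRoots_of, numRoots_of, roots_disjointUnion, Finset.card_disjSum]

theorem numRoots_one : (1 : AromaticForest).numRoots = 0 := rfl

theorem numRoots_le_size (φ : AromaticForest) : φ.numRoots ≤ φ.size := by
  obtain ⟨_, γ, rfl⟩ := φ.exists_of
  rw [numRoots_of, size_of, Nat.card_eq_fintype_card]
  exact Finset.card_le_univ _

theorem elementalOp_of {𝕜 : Type} [RCLike 𝕜] {d : ℕ} {X : Type*} [NormedAddCommGroup X]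
    [NormedSpace 𝕜 X] [Fintype V] [DecidableEq V] (γ : AromaticGraph V)
    (f : (Fin d → 𝕜) → (Fin d → 𝕜)) (G : (Fin d → 𝕜) → X) (y : Fin d → 𝕜) :
    (of γ).elementalOp f G y = γ.elementalOp f G y :=
  ((isIso_relabel _ γ).elementalOp_eq f G y).symm

theorem of_restrict_image {γ : AromaticGraph V} {δ : AromaticGraph W} {g : V → W}
    (hg : Function.Injective g) (h : ∀ v w, δ.Edge (g v) (g w) ↔ γ.Edge v w) {S : Set V}
    {T : Set W} (hT : T = g '' S) : of (δ.restrict T) = of (γ.restrict S) := by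
  subst hT
  exact (of_congr (isIso_image hg h S)).symm

theorem of_restrict_mul_compl {γ : AromaticGraph V} {S : Set V} (h : γ.IsSaturated S) :
    of (γ.restrict S) * of (γ.restrict Sᶜ) = of γ := by
  classical
  exact (of_mul_of _ _).trans (of_congr h.isIso_sumCompl)

theorem of_restrict_union {γ : AromaticGraph V} {S T U : Set V} (hS : γ.IsSaturated S)
    (hST : Disjoint S T) (hU : U = S ∪ T) :
    of (γ.restrict U) = of (γ.restrict S) * of (γ.restrict T) := by
  classical
  subst hU
  exact (of_congr (hS.isIso_union hST)).symm.trans (of_mul_of _ _).symm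

end AromaticForest

open Finset.HasMulAntidiagonal (mulAntidiagonal mem_mulAntidiagonal)

open Classical in
instance : Finset.HasMulAntidiagonal AromaticForest where
  mulAntidiagonal φ :=
    ((Finset.HasAntidiagonal.antidiagonal φ.size).biUnion fun n =>
      AromaticForest.ofSize n.1 ×ˢ AromaticForest.ofSize n.2).filter fun p => p.1 * p.2 = φ
  mem_mulAntidiagonal {φ p} := by
    simp only [Finset.mem_filter, Finset.mem_biUnion, Finset.mem_product, AromaticForest.mem_ofSize,
      Finset.HasAntidiagonal.mem_antidiagonal, and_iff_right_iff_imp]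
    rintro rfl
    exact ⟨(p.1.size, p.2.size), (AromaticForest.size_mul _ _).symm, rfl, rfl⟩

/-! ### Formal series over a monoid -/

/-- Formal series `∑ m, s m • m` over a monoid in which every element has finitely many
factorizations, with formal multiplication. -/
def FormalSeries (M R : Type*) : Type _ := M → R

namespace FormalSeries

variable {M R : Type*} [CommMonoid M] [CommSemiring R]

open Classical in
instance : One (FormalSeries M R) := ⟨fun m => if m = 1 then 1 else 0⟩

open Classical in
theorem one_apply (m : M) : (1 : FormalSeries M R) m = if m = 1 then 1 else 0 := rfl

variable [Finset.HasMulAntidiagonal M]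

instance : Mul (FormalSeries M R) := ⟨fun s t m => ∑ p ∈ mulAntidiagonal m, s p.1 * t p.2⟩

theorem mul_apply (s t : FormalSeries M R) (m : M) :
    (s * t) m = ∑ p ∈ mulAntidiagonal m, s p.1 * t p.2 := rfl

protected theorem mul_comm (s t : FormalSeries M R) : s * t = t * s := by
  funext m
  rw [mul_apply, ← Finset.HasMulAntidiagonal.map_swap_mulAntidiagonal, Finset.sum_map]
  exact Finset.sum_congr rfl fun p _ => mul_comm _ _

protected theorem one_mul (s : FormalSeries M R) : 1 * s = s := by
  funext m
  rw [mul_apply, Finset.sum_eq_single (1, m)]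
  · simp [one_apply]
  · rintro ⟨x, y⟩ hp hne
    obtain rfl : x * y = m := mem_mulAntidiagonal.1 hp
    have hx : x ≠ 1 := fun h => hne (by rw [h, one_mul])
    simp [one_apply, hx]
  · exact fun h => (h (mem_mulAntidiagonal.2 (one_mul m))).elim

protected theorem mul_assoc (s t u : FormalSeries M R) : s * t * u = s * (t * u) := by
  funext m
  simp only [mul_apply, Finset.sum_mul, Finset.mul_sum, Finset.sum_sigma']
  refine Finset.sum_nbij' (fun ⟨⟨_, z⟩, ⟨x, y⟩⟩ => ⟨(x, y * z), (y, z)⟩)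
    (fun ⟨⟨x, _⟩, ⟨y, z⟩⟩ => ⟨(x * y, z), (x, y)⟩) ?_ ?_ ?_ ?_ fun _ _ => mul_assoc _ _ _ <;>
  · rintro ⟨⟨p, q⟩, ⟨p', q'⟩⟩ h
    simp only [Finset.mem_sigma, mem_mulAntidiagonal] at h
    obtain ⟨rfl, rfl⟩ := h
    simp [mul_assoc]

instance : CommMonoid (FormalSeries M R) where
  mul_assoc := FormalSeries.mul_assoc
  mul_comm := FormalSeries.mul_comm
  one_mul := FormalSeries.one_mul
  mul_one s := by rw [FormalSeries.mul_comm, FormalSeries.one_mul]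

end FormalSeries

/-! ### Splittings of a labelled graph -/

namespace AromaticGraph

variable {V W V₁ V₂ : Type}

/-- The isomorphisms from `γ` to `δ`. -/
abbrev Iso (γ : AromaticGraph V) (δ : AromaticGraph W) : Type := {e : V ≃ W // γ.IsIso δ e}

open Classical in
theorem card_iso [Finite V] [Finite W] (γ : AromaticGraph V) (δ : AromaticGraph W) :
    Nat.card (γ.Iso δ) =
      if AromaticForest.of γ = AromaticForest.of δ then (AromaticForest.of γ).sigma else 0 := by
  split_ifs with h
  · obtain ⟨e₀, h₀⟩ := AromaticForest.of_eq_of_iff.1 h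
    rw [AromaticForest.sigma_of]
    exact Nat.card_congr
      { toFun := fun e => ⟨e.1.trans e₀.symm, e.2.trans h₀.symm⟩
        invFun := fun e => ⟨e.1.trans e₀, e.2.trans h₀⟩
        left_inv := fun e => by ext; simp
        right_inv := fun e => by ext; simp }
  · have : IsEmpty (γ.Iso δ) := ⟨fun e => h (AromaticForest.of_congr e.2)⟩
    exact Nat.card_of_isEmpty

variable {γ : AromaticGraph V} {δ₁ : AromaticGraph V₁} {δ₂ : AromaticGraph V₂}

theorem IsIso.isSaturated_range_inl {e : V₁ ⊕ V₂ ≃ V} (he : (δ₁.disjointUnion δ₂).IsIso γ e) :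
    γ.IsSaturated (Set.range (e ∘ Sum.inl)) := by
  intro v w hvw
  obtain ⟨v, rfl⟩ := e.surjective v
  obtain ⟨w, rfl⟩ := e.surjective w
  have h := edge_disjointUnion.1 ((he v w).1 hvw)
  rcases v with v | v <;> rcases w with w | w <;> simp_all

open Classical in
/-- Isomorphisms onto the two parts of a splitting of `γ`, combined to an isomorphism onto `γ`. -/
def gluedIso (x : Σ S : {S : Set V // γ.IsSaturated S},
      δ₁.Iso (γ.restrict S.1) × δ₂.Iso (γ.restrict S.1ᶜ)) :
    (δ₁.disjointUnion δ₂).Iso γ :=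
  ⟨(Equiv.sumCongr x.2.1.1 x.2.2.1).trans (Equiv.Set.sumCompl x.1.1),
    (x.2.1.2.disjointUnion x.2.2.2).trans x.1.2.isIso_sumCompl⟩

theorem gluedIso_injective : Function.Injective (gluedIso (γ := γ) (δ₁ := δ₁) (δ₂ := δ₂)) := by
  intro x y h
  have hS : x.1 = y.1 := Subtype.ext <| by
    have range_inl : ∀ z, Set.range ((gluedIso (γ := γ) (δ₁ := δ₁) (δ₂ := δ₂) z).1 ∘ Sum.inl) =
        z.1.1 := fun ⟨S, e₁, e₂⟩ => by
      ext v
      simpa [gluedIso] using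
        ⟨fun ⟨w, hw⟩ => hw ▸ (e₁.1 w).2, fun hv => ⟨e₁.1.symm ⟨v, hv⟩, by simp⟩⟩
    rw [← range_inl x, ← range_inl y, h]
  obtain ⟨S, e₁, e₂⟩ := x
  obtain ⟨T, e₁', e₂'⟩ := y
  obtain rfl : S = T := hS
  have hv := fun v => Equiv.congr_fun (congrArg Subtype.val h) v
  congr 2
  · ext v
    simpa [gluedIso] using hv (.inl v)
  · ext v
    simpa [gluedIso] using hv (.inr v)

theorem gluedIso_surjective : Function.Surjective (gluedIso (γ := γ) (δ₁ := δ₁) (δ₂ := δ₂)) := by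
  rintro ⟨e, he⟩
  have hcompl : Set.range (e ∘ Sum.inr) = (Set.range (e ∘ Sum.inl))ᶜ := by
    rw [Set.range_comp, Set.range_comp, ← Set.image_compl_eq e.bijective, Set.compl_range_inl]
  have hl := e.injective.comp Sum.inl_injective
  have hr := e.injective.comp Sum.inr_injective
  refine ⟨⟨⟨_, he.isSaturated_range_inl⟩, ⟨Equiv.ofInjective _ hl, isIso_ofInjective hl ?_⟩,
    ⟨(Equiv.ofInjective _ hr).trans (Equiv.setCongr hcompl), ?_⟩⟩, ?_⟩
  · simp [he _ _, edge_disjointUnion]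
  · intro v w
    simp [edge_restrict, he _ _, edge_disjointUnion]
  · ext (v | v) <;> simp [gluedIso]

end AromaticGraph

namespace AromaticForest

open AromaticGraph

variable {V : Type} [Finite V]

open Classical in
theorem card_splittings_mul [Fintype (Set V)] {γ : AromaticGraph V} {φ ψ : AromaticForest}
    (h : φ * ψ = of γ) :
    Finset.card {S : Set V | γ.IsSaturated S ∧ of (γ.restrict S) = φ ∧ of (γ.restrict Sᶜ) = ψ} *
      (φ.sigma * ψ.sigma) = (of γ).sigma := by
  obtain ⟨⟨_, δ₁, rfl⟩, ⟨_, δ₂, rfl⟩⟩ := φ.exists_of, ψ.exists_of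
  calc
    _ = ∑ S : Set V with γ.IsSaturated S,
          Nat.card (δ₁.Iso (γ.restrict S)) * Nat.card (δ₂.Iso (γ.restrict Sᶜ)) := by
      simp only [card_iso, ite_zero_mul_ite_zero, ← Finset.sum_filter, Finset.filter_filter,
        Finset.sum_const, smul_eq_mul, eq_comm]
    _ = ∑ S : {S : Set V // γ.IsSaturated S},
          Nat.card (δ₁.Iso (γ.restrict S.1)) * Nat.card (δ₂.Iso (γ.restrict S.1ᶜ)) :=
      (Finset.sum_subtype _ (by simp) _)
    _ = Nat.card (Σ S : {S : Set V // γ.IsSaturated S},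
          δ₁.Iso (γ.restrict S.1) × δ₂.Iso (γ.restrict S.1ᶜ)) := by
      simp only [Nat.card_sigma, Nat.card_prod]
    _ = Nat.card ((δ₁.disjointUnion δ₂).Iso γ) :=
      Nat.card_congr (Equiv.ofBijective _ ⟨gluedIso_injective, gluedIso_surjective⟩)
    _ = (of γ).sigma := by rw [card_iso, ← of_mul_of, if_pos h, h]

open Classical in
theorem sum_isSaturated [Fintype (Set V)] {𝕜 : Type*} [Field 𝕜] [CharZero 𝕜] (γ : AromaticGraph V)
    (F : AromaticForest → AromaticForest → 𝕜) :
    ∑ S : Set V with γ.IsSaturated S, F (of (γ.restrict S)) (of (γ.restrict Sᶜ)) =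
      (of γ).sigma * ∑ p ∈ mulAntidiagonal (of γ),
        F p.1 p.2 / ((p.1.sigma : 𝕜) * (p.2.sigma : 𝕜)) := by
  rw [← Finset.sum_fiberwise_of_maps_to (t := mulAntidiagonal (of γ))
    (g := fun S => (of (γ.restrict S), of (γ.restrict Sᶜ))), Finset.mul_sum]
  · refine Finset.sum_congr rfl fun p hp => ?_
    rw [Finset.sum_congr rfl (g := fun _ => F p.1 p.2), Finset.sum_const, nsmul_eq_mul]
    · rw [← card_splittings_mul (mem_mulAntidiagonal.1 hp), Finset.filter_filter]
      have h₁ : (p.1.sigma : 𝕜) ≠ 0 := Nat.cast_ne_zero.2 p.1.sigma_pos.ne'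
      have h₂ : (p.2.sigma : 𝕜) ≠ 0 := Nat.cast_ne_zero.2 p.2.sigma_pos.ne'
      simp only [Prod.ext_iff]
      push_cast
      field_simp
    · intro S hS
      rw [← (Finset.mem_filter.1 hS).2]
  · intro S hS
    exact mem_mulAntidiagonal.2 (of_restrict_mul_compl (Finset.mem_filter.1 hS).2)

end AromaticForest

/-! ### Multiplicative induced maps -/

section InducedMap

variable {𝕜 : Type} [Field 𝕜]

/-- The series `∑ φ, b(φ) / σ(φ) φ` with the normalized coefficients. -/
def normalized (b : AromaticForest → 𝕜) : FormalSeries AromaticForest 𝕜 :=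
  fun φ => b φ / (φ.sigma : 𝕜)

theorem sum_rootlessFactorizations {M : Type*} [AddCommMonoid M] (γ : RootlessForest)
    (F : AromaticForest → AromaticForest → M) :
    ∑ p ∈ rootlessFactorizations γ, F p.1.1 p.2.1 = ∑ p ∈ mulAntidiagonal γ.1, F p.1 p.2 := by
  refine Finset.sum_bij (fun p _ => (p.1.1, p.2.1)) ?_ ?_ ?_ fun _ _ => rfl
  · exact fun p hp => mem_mulAntidiagonal.2 ((mem_rootlessFactorizations γ p).1 hp)
  · rintro ⟨p₁, p₂⟩ _ ⟨q₁, q₂⟩ _ h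
    simpa [Prod.ext_iff, Subtype.ext_iff] using h
  · rintro ⟨φ, ψ⟩ hp
    rw [mem_mulAntidiagonal] at hp
    have h : φ.numRoots = 0 ∧ ψ.numRoots = 0 := by
      rw [← Nat.add_eq_zero_iff, ← AromaticForest.numRoots_mul, hp, γ.2]
    exact ⟨(⟨φ, h.1⟩, ⟨ψ, h.2⟩), (mem_rootlessFactorizations γ _).2 hp, rfl⟩

namespace RootlessDual

theorem ext_coeff {a b : RootlessDual 𝕜} (h : ∀ γ, a.coeff γ = b.coeff γ) : a = b :=
  Finsupp.lhom_ext' fun γ => LinearMap.ext_ring (h γ)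

theorem coeff_add (a b : RootlessDual 𝕜) (γ : RootlessForest) :
    (a + b).coeff γ = a.coeff γ + b.coeff γ := rfl

theorem coeff_smul (c : 𝕜) (a : RootlessDual 𝕜) (γ : RootlessForest) :
    (c • a).coeff γ = c * a.coeff γ := rfl

theorem coeff_one (γ : RootlessForest) :
    (one : RootlessDual 𝕜).coeff γ = (1 : FormalSeries AromaticForest 𝕜) γ.1 := by
  simp [coeff, one, FormalSeries.one_apply]

theorem coeff_mul (a b : RootlessDual 𝕜) (γ : RootlessForest) :
    (a.mul b).coeff γ = (γ.1.sigma : 𝕜) * ∑ p ∈ rootlessFactorizations γ,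
      (a.coeff p.1 / (p.1.1.sigma : 𝕜)) * (b.coeff p.2 / (p.2.1.sigma : 𝕜)) := by
  simp [coeff, mul]

variable (𝕜) in
/-- The product of `RootlessDual 𝕜` as a bilinear map. -/
def mulBilin : RootlessDual 𝕜 →ₗ[𝕜] RootlessDual 𝕜 →ₗ[𝕜] RootlessDual 𝕜 :=
  LinearMap.mk₂ 𝕜 mul
    (fun a b c => ext_coeff fun γ => by
      simp only [coeff_mul, coeff_add, add_div, add_mul, Finset.sum_add_distrib, mul_add])
    (fun r a b => ext_coeff fun γ => by
      simp only [coeff_mul, coeff_smul, Finset.mul_sum]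
      exact Finset.sum_congr rfl fun _ _ => by ring)
    (fun a b c => ext_coeff fun γ => by
      simp only [coeff_mul, coeff_add, add_div, mul_add, Finset.sum_add_distrib])
    (fun r a b => ext_coeff fun γ => by
      simp only [coeff_mul, coeff_smul, Finset.mul_sum]
      exact Finset.sum_congr rfl fun _ _ => by ring)

end RootlessDual

theorem coeff_inducedMap_of (b : AromaticForest → 𝕜) (φ : LooplessForest) (γ : RootlessForest) :
    (inducedMap b (MonoidAlgebra.single φ 1)).coeff γ = b (γ.1 * φ.1) := by
  simp [inducedMap, RootlessDual.coeff]

theorem isAlgebraMorphism_inducedMap_iff_single {b : AromaticForest → 𝕜} :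
    IsAlgebraMorphism (inducedMap b) ↔
      inducedMap b (MonoidAlgebra.single 1 1) = RootlessDual.one ∧
      ∀ φ ψ : LooplessForest, inducedMap b (MonoidAlgebra.single (φ * ψ) 1) =
        (inducedMap b (MonoidAlgebra.single φ 1)).mul
          (inducedMap b (MonoidAlgebra.single ψ 1)) := by
  refine ⟨fun h => ⟨h.map_one, fun φ ψ => ?_⟩, fun ⟨h_one, h_mul⟩ => ⟨h_one, fun x y => ?_⟩⟩
  · rw [← h.map_mul, MonoidAlgebra.single_mul_single, one_mul]
  · have hsmul : ∀ (φ : LooplessForest) (r : 𝕜),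
        (MonoidAlgebra.single φ r : ForestAlgebra 𝕜) = r • MonoidAlgebra.single φ 1 :=
      fun φ r => by rw [MonoidAlgebra.smul_single, smul_eq_mul, mul_one]
    change inducedMap b (x * y) = RootlessDual.mulBilin 𝕜 (inducedMap b x) (inducedMap b y)
    induction x using MonoidAlgebra.induction_linear with
    | zero => simp
    | add x₁ x₂ h₁ h₂ => simp [add_mul, h₁, h₂]
    | single φ r =>
      induction y using MonoidAlgebra.induction_linear with
      | zero => simp
      | add y₁ y₂ h₁ h₂ => simp only [mul_add, h₁, h₂, map_add]
      | single ψ s =>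
        rw [MonoidAlgebra.single_mul_single, hsmul φ, hsmul ψ, hsmul (φ * ψ), map_smul, map_smul,
          map_smul, h_mul, map_smul, map_smul, LinearMap.smul_apply, smul_smul, mul_comm r s]
        rfl

theorem isAlgebraMorphism_inducedMap_iff [CharZero 𝕜] {b : AromaticForest → 𝕜} :
    IsAlgebraMorphism (inducedMap b) ↔
      (∀ γ : RootlessForest, b γ.1 = (1 : FormalSeries AromaticForest 𝕜) γ.1) ∧
      ∀ (φ ψ : LooplessForest) (γ : RootlessForest),
        normalized (fun γ => b (γ * (φ.1 * ψ.1))) γ.1 =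
          (normalized (fun γ => b (γ * φ.1)) * normalized (fun γ => b (γ * ψ.1))) γ.1 := by
  rw [isAlgebraMorphism_inducedMap_iff_single]
  have coeff_ext : ∀ {a b : RootlessDual 𝕜}, a = b ↔ ∀ γ, a.coeff γ = b.coeff γ :=
    ⟨fun h _ => h ▸ rfl, RootlessDual.ext_coeff⟩
  refine and_congr (coeff_ext.trans <| forall_congr' fun γ => ?_) <|
    forall₂_congr fun φ ψ => coeff_ext.trans <| forall_congr' fun γ => ?_
  · rw [coeff_inducedMap_of, RootlessDual.coeff_one]
    exact Eq.congr_left (congrArg b (mul_one _))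
  · have hγ : (γ.1.sigma : 𝕜) ≠ 0 := Nat.cast_ne_zero.2 γ.1.sigma_pos.ne'
    simp only [RootlessDual.coeff_mul, coeff_inducedMap_of]
    rw [sum_rootlessFactorizations γ fun γ₁ γ₂ =>
      b (γ₁ * φ.1) / (γ₁.sigma : 𝕜) * (b (γ₂ * ψ.1) / (γ₂.sigma : 𝕜)), normalized, div_eq_iff hγ,
      mul_comm (γ.1.sigma : 𝕜)]
    rfl

end InducedMap

/-! ### The rootless core and the trees of the roots -/

namespace AromaticGraph

open AromaticForest

variable {V W : Type}

/-- The nodes from which there is a directed path to `r`. If `r` is a root, this is its connected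
component. -/
def ancestors (γ : AromaticGraph V) (r : V) : Set V := {v | Relation.ReflTransGen γ.Edge v r}

/-- The nodes from which there is no directed path to a root. -/
def core (γ : AromaticGraph V) : Set V := {v | ∀ r, γ r = none → v ∉ γ.ancestors r}

theorem Edge.eq {γ : AromaticGraph V} {v w w' : V} (h : γ.Edge v w) (h' : γ.Edge v w') : w = w' :=
  Option.some_injective _ (h.symm.trans h')

theorem not_edge_of_eq_none {γ : AromaticGraph V} {r w : V} (hr : γ r = none) : ¬ γ.Edge r w :=
  Option.eq_none_iff_forall_ne_some.1 hr w

theorem self_mem_ancestors (γ : AromaticGraph V) (r : V) : r ∈ γ.ancestors r := .refl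

theorem isSaturated_ancestors {γ : AromaticGraph V} {r : V} (hr : γ r = none) :
    γ.IsSaturated (γ.ancestors r) := by
  intro v w hvw
  refine ⟨fun h => ?_, fun h => .head hvw h⟩
  rcases Relation.ReflTransGen.cases_head h with rfl | ⟨w', hw', h'⟩
  · exact (not_edge_of_eq_none hr hvw).elim
  · rwa [hvw.eq hw']

theorem eq_of_mem_ancestors {γ : AromaticGraph V} {r r' v : V} (hr : γ r = none)
    (hr' : γ r' = none) (h : v ∈ γ.ancestors r) (h' : v ∈ γ.ancestors r') : r = r' := by
  induction h using Relation.ReflTransGen.head_induction_on with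
  | refl =>
    rcases Relation.ReflTransGen.cases_head h' with rfl | ⟨w, hw, _⟩
    · rfl
    · exact (not_edge_of_eq_none hr hw).elim
  | head hvw _ ih => exact ih ((isSaturated_ancestors hr' _ _ hvw).1 h')

theorem isSaturated_core (γ : AromaticGraph V) : γ.IsSaturated γ.core := fun v w hvw =>
  forall₂_congr fun _ hr => not_congr (isSaturated_ancestors hr v w hvw)

theorem ne_none_of_mem_core {γ : AromaticGraph V} {v : V} (hv : v ∈ γ.core) : γ v ≠ none :=
  fun h => hv v h (γ.self_mem_ancestors v)

theorem IsIso.eq_none_iff {γ : AromaticGraph V} {δ : AromaticGraph W} {e : V ≃ W}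
    (h : γ.IsIso δ e) (v : V) : δ (e v) = none ↔ γ v = none := by
  simp only [Option.eq_none_iff_forall_ne_some, ← e.forall_congr_right (q := fun w => _ ≠ some w)]
  exact forall_congr' fun w => not_congr (h v w)

theorem ancestors_apply {γ : AromaticGraph V} {δ : AromaticGraph W} {g : V → W}
    (hg : ∀ v w, δ.Edge (g v) (g w) ↔ γ.Edge v w)
    (hg_pred : ∀ x v, δ.Edge x (g v) → x ∈ Set.range g) (r : V) :
    δ.ancestors (g r) = g '' γ.ancestors r := by
  ext x
  constructor
  · intro h
    induction h using Relation.ReflTransGen.head_induction_on with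
    | refl => exact ⟨r, .refl, rfl⟩
    | head hxy _ ih =>
      obtain ⟨w, hw, rfl⟩ := ih
      obtain ⟨v, rfl⟩ := hg_pred _ _ hxy
      exact ⟨v, .head ((hg v w).1 hxy) hw, rfl⟩
  · rintro ⟨v, hv, rfl⟩
    exact Relation.ReflTransGen.lift (r := γ.Edge) g (fun a b => (hg a b).2) v r hv

theorem IsIso.ancestors_eq {γ : AromaticGraph V} {δ : AromaticGraph W} {e : V ≃ W}
    (h : γ.IsIso δ e) (r : V) : δ.ancestors (e r) = e '' γ.ancestors r :=
  ancestors_apply h (fun x _ _ => e.surjective x) r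

theorem IsIso.core_eq {γ : AromaticGraph V} {δ : AromaticGraph W} {e : V ≃ W}
    (h : γ.IsIso δ e) : δ.core = e '' γ.core := by
  ext w
  obtain ⟨v, rfl⟩ := e.surjective w
  rw [e.injective.mem_set_image, core, Set.mem_ofPred_eq, ← e.forall_congr_right]
  simp only [h.eq_none_iff, h.ancestors_eq, e.injective.mem_set_image]
  rfl

theorem ancestors_disjointUnion_inl (γ : AromaticGraph V) (δ : AromaticGraph W) (r : V) :
    (γ.disjointUnion δ).ancestors (.inl r) = Sum.inl '' γ.ancestors r := by
  refine ancestors_apply (fun v w => by simp [edge_disjointUnion]) ?_ r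
  rintro (x | x) v <;> simp [edge_disjointUnion]

theorem ancestors_disjointUnion_inr (γ : AromaticGraph V) (δ : AromaticGraph W) (r : W) :
    (γ.disjointUnion δ).ancestors (.inr r) = Sum.inr '' δ.ancestors r := by
  refine ancestors_apply (fun v w => by simp [edge_disjointUnion]) ?_ r
  rintro (x | x) v <;> simp [edge_disjointUnion]

theorem core_disjointUnion (γ : AromaticGraph V) (δ : AromaticGraph W) :
    (γ.disjointUnion δ).core = Sum.inl '' γ.core ∪ Sum.inr '' δ.core := by
  have hγ : ∀ r, γ.disjointUnion δ (.inl r) = none ↔ γ r = none := by simp [disjointUnion]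
  have hδ : ∀ r, γ.disjointUnion δ (.inr r) = none ↔ δ r = none := by simp [disjointUnion]
  ext (v | v) <;> simp [core, hγ, hδ, ancestors_disjointUnion_inl, ancestors_disjointUnion_inr,
    imp_not_comm (b := _ = _)]

theorem Loopless.core_eq_empty [Finite V] {γ : AromaticGraph V} (h : γ.Loopless) :
    γ.core = ∅ := by
  have : IsTrans V fun v w => Relation.TransGen γ.Edge w v := ⟨fun _ _ _ h h' => h'.trans h⟩
  have : Std.Irrefl fun v w => Relation.TransGen γ.Edge w v := ⟨h⟩
  have wf := Finite.wellFounded_of_trans_of_irrefl fun v w => Relation.TransGen γ.Edge w v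
  refine Set.eq_empty_of_forall_notMem fun v => ?_
  induction v using wf.induction with
  | h v ih =>
    intro hv
    obtain ⟨w, hw⟩ := Option.ne_none_iff_exists'.1 (ne_none_of_mem_core hv)
    exact ih w (.single hw) ((γ.isSaturated_core v w hw).1 hv)

theorem not_transGen_of_mem_ancestors {γ : AromaticGraph V} {r v : V} (hr : γ r = none)
    (hv : v ∈ γ.ancestors r) : ¬ Relation.TransGen γ.Edge v v := by
  induction hv using Relation.ReflTransGen.head_induction_on with
  | refl =>
    intro h
    obtain ⟨w, hw, _⟩ := Relation.TransGen.head'_iff.1 h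
    exact not_edge_of_eq_none hr hw
  | head hvw _ ih =>
    intro h
    obtain ⟨w', hw', h'⟩ := Relation.TransGen.head'_iff.1 h
    obtain rfl := hvw.eq hw'
    exact ih (.tail' h' hw')

theorem loopless_restrict_compl_core (γ : AromaticGraph V) : (γ.restrict γ.coreᶜ).Loopless := by
  rintro ⟨v, hv⟩ hloop
  obtain ⟨r, hr, hvr⟩ : ∃ r, γ r = none ∧ v ∈ γ.ancestors r := by simpa [core] using hv
  exact not_transGen_of_mem_ancestors hr hvr
    (hloop.lift Subtype.val fun _ _ hab => edge_restrict.1 hab)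

/-- The connected components of the roots of `γ`. -/
def treeParts [Fintype V] [DecidableEq V] (γ : AromaticGraph V) : Multiset AromaticForest :=
  γ.roots.val.map fun r => of (γ.restrict (γ.ancestors r))

theorem IsIso.treeParts_eq [Fintype V] [DecidableEq V] [Fintype W] [DecidableEq W]
    {γ : AromaticGraph V} {δ : AromaticGraph W} {e : V ≃ W} (h : γ.IsIso δ e) :
    δ.treeParts = γ.treeParts := by
  rw [treeParts, treeParts, h.roots_eq, Finset.map_val, Multiset.map_map]
  exact Multiset.map_congr rfl fun r _ => of_restrict_image e.injective h (h.ancestors_eq r)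

theorem IsIso.of_restrict_core [Finite V] [Finite W] {γ : AromaticGraph V} {δ : AromaticGraph W}
    {e : V ≃ W} (h : γ.IsIso δ e) : of (δ.restrict δ.core) = of (γ.restrict γ.core) :=
  of_restrict_image e.injective h h.core_eq

end AromaticGraph

namespace AromaticForest

open AromaticGraph

/-- The multiset of the trees of the roots of an aromatic forest. -/
def treeParts (φ : AromaticForest) : Multiset AromaticForest :=
  Quotient.lift (s := aromaticSetoid φ.1) (fun γ => γ.treeParts)
    (fun _ _ ⟨_, h⟩ => h.treeParts_eq.symm) φ.2

/-- The largest rootless factor of an aromatic forest: the class of its core. -/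
def rootlessPart (φ : AromaticForest) : AromaticForest :=
  Quotient.lift (s := aromaticSetoid φ.1) (fun γ => of (γ.restrict γ.core))
    (fun _ _ ⟨_, h⟩ => h.of_restrict_core.symm) φ.2

theorem treeParts_of {V : Type} [Fintype V] [DecidableEq V] (γ : AromaticGraph V) :
    (of γ).treeParts = γ.treeParts := (isIso_relabel (Finite.equivFin V) γ).treeParts_eq

theorem rootlessPart_of {V : Type} [Finite V] (γ : AromaticGraph V) :
    (of γ).rootlessPart = of (γ.restrict γ.core) :=
  (isIso_relabel (Finite.equivFin V) γ).of_restrict_core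

theorem treeParts_mul (φ ψ : AromaticForest) :
    (φ * ψ).treeParts = φ.treeParts + ψ.treeParts := by
  obtain ⟨⟨_, γ, rfl⟩, ⟨_, δ, rfl⟩⟩ := φ.exists_of, ψ.exists_of
  rw [of_mul_of, treeParts_of, treeParts_of, treeParts_of, AromaticGraph.treeParts,
    roots_disjointUnion, Finset.val_disjSum, Multiset.disjSum, Multiset.map_add,
    Multiset.map_map, Multiset.map_map]
  congr 1 <;> refine Multiset.map_congr rfl fun r _ => ?_
  · exact of_restrict_image Sum.inl_injective (fun v w => by simp [edge_disjointUnion])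
      (ancestors_disjointUnion_inl γ δ r)
  · exact of_restrict_image Sum.inr_injective (fun v w => by simp [edge_disjointUnion])
      (ancestors_disjointUnion_inr γ δ r)

theorem rootlessPart_mul (φ ψ : AromaticForest) :
    (φ * ψ).rootlessPart = φ.rootlessPart * ψ.rootlessPart := by
  obtain ⟨⟨_, γ, rfl⟩, ⟨_, δ, rfl⟩⟩ := φ.exists_of, ψ.exists_of
  have hsat : (γ.disjointUnion δ).IsSaturated (Sum.inl '' γ.core) := by
    rintro _ _ e
    obtain h | h := edge_disjointUnion.1 e
    · simpa using γ.isSaturated_core _ _ h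
    · simp
  rw [of_mul_of, rootlessPart_of, rootlessPart_of, rootlessPart_of,
    of_restrict_union hsat Set.disjoint_image_inl_image_inr (core_disjointUnion γ δ),
    of_restrict_image (γ := γ) Sum.inl_injective (fun v w => by simp [edge_disjointUnion]) rfl,
    of_restrict_image (γ := δ) Sum.inr_injective (fun v w => by simp [edge_disjointUnion]) rfl]

theorem numRoots_rootlessPart (φ : AromaticForest) : φ.rootlessPart.numRoots = 0 := by
  classical
  obtain ⟨_, γ, rfl⟩ := φ.exists_of
  have := Fintype.ofFinite γ.core
  rw [rootlessPart_of, numRoots_of, Finset.card_eq_zero, roots, Finset.filter_eq_empty_iff]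
  exact fun v _ hv => ne_none_of_mem_core v.2 ((γ.isSaturated_core.restrict_eq_none v).1 hv)

theorem treeParts_eq_zero {φ : AromaticForest} (h : φ.numRoots = 0) : φ.treeParts = 0 := by
  obtain ⟨_, γ, rfl⟩ := φ.exists_of
  rw [numRoots_of, Finset.card_eq_zero] at h
  rw [treeParts_of, AromaticGraph.treeParts, h, Finset.empty_val, Multiset.map_zero]

theorem rootlessPart_eq_self {φ : AromaticForest} (h : φ.numRoots = 0) : φ.rootlessPart = φ := by
  obtain ⟨_, γ, rfl⟩ := φ.exists_of
  rw [numRoots_of, Finset.card_eq_zero, roots, Finset.filter_eq_empty_iff] at h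
  have hcore : γ.core = Set.univ :=
    Set.eq_univ_of_forall fun _ r hr => (h (Finset.mem_univ r) hr).elim
  rw [rootlessPart_of, hcore]
  exact of_congr (e := Equiv.Set.univ _) fun v w => edge_restrict.symm

theorem IsLoopless.rootlessPart_eq_one {φ : AromaticForest} (h : φ.IsLoopless) :
    φ.rootlessPart = 1 := by
  obtain ⟨_, γ, rfl⟩ := φ.exists_of
  rw [isLoopless_of] at h
  rw [rootlessPart_of, h.core_eq_empty, of_eq_one]

theorem exists_treeParts_eq_singleton {φ : AromaticForest} (h : φ.numRoots = 1) :
    ∃ τ : AromaticForest, φ.treeParts = {τ} ∧ φ.rootlessPart * τ = φ := by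
  obtain ⟨_, γ, rfl⟩ := φ.exists_of
  rw [numRoots_of, Finset.card_eq_one] at h
  obtain ⟨r, hr⟩ := h
  have hroot : ∀ v, γ v = none ↔ v = r := by simpa [roots, Finset.ext_iff] using hr
  have hcore : γ.ancestors r = γ.coreᶜ := by
    ext v
    simp [core, hroot]
  refine ⟨of (γ.restrict (γ.ancestors r)), ?_, ?_⟩
  · rw [treeParts_of, AromaticGraph.treeParts, hr, Finset.singleton_val, Multiset.map_singleton]
  · rw [rootlessPart_of, hcore, of_restrict_mul_compl γ.isSaturated_core]

end AromaticForest

/-! ### The multiplicative extension -/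

section Extension

open AromaticForest

variable {𝕜 : Type} [Field 𝕜]

/-- The extension by zero of a function on the aromatic trees. -/
def treeExtension (a : AromaticTree → 𝕜) (φ : AromaticForest) : 𝕜 :=
  if h : φ.numRoots = 1 then a ⟨φ, h⟩ else 0

theorem treeExtension_of_numRoots_eq_one (a : AromaticTree → 𝕜) {φ : AromaticForest}
    (h : φ.numRoots = 1) : treeExtension a φ = a ⟨φ, h⟩ := dif_pos h

theorem treeExtension_of_numRoots_ne_one (a : AromaticTree → 𝕜) {φ : AromaticForest}
    (h : φ.numRoots ≠ 1) : treeExtension a φ = 0 := dif_neg h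

/-- The series `∑ γ, a(γ τ) / σ(γ) γ`, which records the values of `a` on the aromatic trees with
tree part `τ`. -/
def treeSeries (a : AromaticTree → 𝕜) (τ : AromaticForest) : FormalSeries AromaticForest 𝕜 :=
  normalized fun γ => treeExtension a (γ * τ)

/-- The multiplicative extension of `a`: its normalized values `b(γ φ) / σ(γ)`, for `γ` rootless and
`φ` without cycles, are the coefficients of the product of the series of the trees of `φ`. -/
def multiplicativeExtension (a : AromaticTree → 𝕜) (φ : AromaticForest) : 𝕜 :=
  φ.rootlessPart.sigma * (φ.treeParts.map (treeSeries a)).prod φ.rootlessPart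

variable [CharZero 𝕜]

theorem normalized_multiplicativeExtension_mul (a : AromaticTree → 𝕜) {γ φ : AromaticForest}
    (hγ : γ.numRoots = 0) (hφ : φ.IsLoopless) :
    normalized (fun γ => multiplicativeExtension a (γ * φ)) γ =
      (φ.treeParts.map (treeSeries a)).prod γ := by
  have hpart : (γ * φ).rootlessPart = γ := by
    rw [rootlessPart_mul, hφ.rootlessPart_eq_one, mul_one, rootlessPart_eq_self hγ]
  have htrees : (γ * φ).treeParts = φ.treeParts := by
    rw [treeParts_mul, treeParts_eq_zero hγ, zero_add]
  have hσ : (γ.sigma : 𝕜) ≠ 0 := Nat.cast_ne_zero.2 γ.sigma_pos.ne'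
  rw [normalized, multiplicativeExtension, hpart, htrees, mul_div_cancel_left₀ _ hσ]

theorem isMultiplicativeExtension_multiplicativeExtension (a : AromaticTree → 𝕜) :
    IsMultiplicativeExtension a (multiplicativeExtension a) where
  eq_on_trees τ := by
    obtain ⟨ψ, htrees, hτ⟩ := exists_treeParts_eq_singleton τ.2
    have hσ : (τ.1.rootlessPart.sigma : 𝕜) ≠ 0 := Nat.cast_ne_zero.2 (sigma_pos _).ne'
    rw [multiplicativeExtension, htrees, Multiset.map_singleton, Multiset.prod_singleton,
      treeSeries, normalized, hτ, treeExtension_of_numRoots_eq_one a τ.2, mul_div_cancel₀ _ hσ]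
  isAlgebraMorphism := by
    refine isAlgebraMorphism_inducedMap_iff.2 ⟨fun γ => ?_, fun φ ψ γ => ?_⟩
    · rw [multiplicativeExtension, treeParts_eq_zero γ.2, Multiset.map_zero, Multiset.prod_zero,
        rootlessPart_eq_self γ.2, FormalSeries.one_apply]
      split_ifs with h
      · rw [h, sigma_one, Nat.cast_one, mul_one]
      · rw [mul_zero]
    · rw [normalized_multiplicativeExtension_mul a γ.2 (φ.2.mul ψ.2), treeParts_mul,
        Multiset.map_add, Multiset.prod_add, FormalSeries.mul_apply, FormalSeries.mul_apply]
      refine Finset.sum_congr rfl fun p hp => ?_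
      have hroots : p.1.numRoots = 0 ∧ p.2.numRoots = 0 := by
        rw [← Nat.add_eq_zero_iff, ← numRoots_mul, mem_mulAntidiagonal.1 hp, γ.2]
      rw [normalized_multiplicativeExtension_mul a hroots.1 φ.2,
        normalized_multiplicativeExtension_mul a hroots.2 ψ.2]

end Extension

/-! ### Splitting off the component of a root -/

namespace AromaticGraph

open AromaticForest

variable {V : Type} {γ : AromaticGraph V} {S T : Set V} {r : V}

theorem Loopless.restrict_mono (hST : S ⊆ T) (h : (γ.restrict T).Loopless) :
    (γ.restrict S).Loopless := fun v hv =>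
  h (Set.inclusion hST v) (Relation.TransGen.lift (r := (γ.restrict S).Edge)
    (p := (γ.restrict T).Edge) (Set.inclusion hST) (fun _ _ hab =>
      edge_restrict.2 ((edge_restrict (S := S)).1 hab)) _ _ hv)

namespace IsSaturated

theorem image_val (hS : γ.IsSaturated S) {T : Set S} (hT : (γ.restrict S).IsSaturated T) :
    γ.IsSaturated (Subtype.val '' T) := by
  intro v w hvw
  constructor
  · rintro ⟨x, hx, rfl⟩
    have hw : w ∈ S := (hS _ _ hvw).1 x.2
    exact ⟨⟨w, hw⟩, (hT x ⟨w, hw⟩ (edge_restrict.2 hvw)).1 hx, rfl⟩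
  · rintro ⟨x, hx, rfl⟩
    have hv : v ∈ S := (hS _ _ hvw).2 x.2
    exact ⟨⟨v, hv⟩, (hT ⟨v, hv⟩ x (edge_restrict.2 hvw)).2 hx, rfl⟩

theorem preimage_val (hT : γ.IsSaturated T) :
    (γ.restrict S).IsSaturated (Subtype.val ⁻¹' T) := fun _ _ hvw => hT _ _ (edge_restrict.1 hvw)

theorem mem_iff_of_mem_ancestors (hT : γ.IsSaturated T) {v : V} (h : v ∈ γ.ancestors r) :
    v ∈ T ↔ r ∈ T := by
  induction h using Relation.ReflTransGen.head_induction_on with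
  | refl => rfl
  | head hvw _ ih => exact (hT _ _ hvw).trans ih

end IsSaturated

theorem disjoint_core_ancestors (hr : γ r = none) : Disjoint γ.core (γ.ancestors r) :=
  Set.disjoint_left.2 fun _ hv hv' => hv r hr hv'

/-- The union of the connected components of the roots other than `r`. -/
def otherTrees (γ : AromaticGraph V) (r : V) : Set V := (γ.core ∪ γ.ancestors r)ᶜ

theorem isSaturated_core_union_ancestors (hr : γ r = none) :
    γ.IsSaturated (γ.core ∪ γ.ancestors r) := γ.isSaturated_core.union (isSaturated_ancestors hr)

theorem of_eq_core_mul_ancestors_mul_otherTrees [Finite V] (hr : γ r = none) :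
    of γ = of (γ.restrict γ.core) *
      (of (γ.restrict (γ.ancestors r)) * of (γ.restrict (γ.otherTrees r))) := by
  rw [← mul_assoc, ← of_restrict_union γ.isSaturated_core (disjoint_core_ancestors hr) rfl,
    otherTrees, of_restrict_mul_compl (isSaturated_core_union_ancestors hr)]

theorem of_restrict_image_union_ancestors [Finite V] (hr : γ r = none) {S : Set γ.core}
    (hS : (γ.restrict γ.core).IsSaturated S) :
    of (γ.restrict (Subtype.val '' S ∪ γ.ancestors r)) =
      of ((γ.restrict γ.core).restrict S) * of (γ.restrict (γ.ancestors r)) := by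
  rw [of_restrict_union (γ.isSaturated_core.image_val hS)
    ((disjoint_core_ancestors hr).mono_left (Subtype.coe_image_subset _ _)) rfl,
    of_restrict_image Subtype.val_injective (fun _ _ => edge_restrict.symm) rfl]

theorem of_restrict_compl_image_union_ancestors [Finite V] (hr : γ r = none) {S : Set γ.core}
    (hS : (γ.restrict γ.core).IsSaturated S) :
    of (γ.restrict (Subtype.val '' S ∪ γ.ancestors r)ᶜ) =
      of ((γ.restrict γ.core).restrict Sᶜ) * of (γ.restrict (γ.otherTrees r)) := by
  have hcompl : (Subtype.val '' S ∪ γ.ancestors r)ᶜ = Subtype.val '' Sᶜ ∪ γ.otherTrees r := by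
    ext v
    by_cases hv : v ∈ γ.core
    · simp [otherTrees, hv, Set.disjoint_left.1 (disjoint_core_ancestors hr) hv]
    · simp [otherTrees, hv]
  have hdisj : Disjoint (Subtype.val '' Sᶜ) (γ.otherTrees r) :=
    disjoint_compl_right.mono_left
      ((Subtype.coe_image_subset _ _).trans Set.subset_union_left)
  rw [of_restrict_union (γ.isSaturated_core.image_val hS.compl) hdisj hcompl,
    of_restrict_image Subtype.val_injective (fun _ _ => edge_restrict.symm) rfl]

section RootsIn

variable [Fintype V]

open Classical in
/-- The roots of `γ` that lie in `T`. -/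
def rootsIn (γ : AromaticGraph V) (T : Set V) : Finset V := γ.roots.filter (· ∈ T)

theorem mem_rootsIn {v : V} : v ∈ γ.rootsIn T ↔ γ v = none ∧ v ∈ T := by
  simp [rootsIn, roots]

theorem numRoots_of_restrict (hT : γ.IsSaturated T) :
    (of (γ.restrict T)).numRoots = (γ.rootsIn T).card := by
  classical
  have : (γ.restrict T).roots.map (Function.Embedding.subtype (· ∈ T)) = γ.rootsIn T := by
    ext v
    simp [mem_rootsIn, roots, hT.restrict_eq_none]
  rw [numRoots_of, ← this, Finset.card_map]

theorem rootsIn_union_ancestors (hr : γ r = none) (hS : S ⊆ γ.core) :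
    γ.rootsIn (S ∪ γ.ancestors r) = {r} := by
  ext v
  rw [mem_rootsIn, Finset.mem_singleton]
  constructor
  · rintro ⟨hv, h | h⟩
    · exact (ne_none_of_mem_core (hS h) hv).elim
    · exact eq_of_mem_ancestors hv hr (γ.self_mem_ancestors v) h
  · rintro rfl
    exact ⟨hr, .inr (γ.self_mem_ancestors v)⟩

theorem core_inter_union_ancestors (hT : γ.IsSaturated T) (h : γ.rootsIn T = {r}) :
    γ.core ∩ T ∪ γ.ancestors r = T := by
  have hrT : r ∈ T := (mem_rootsIn.1 (h ▸ Finset.mem_singleton_self r)).2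
  refine (Set.union_subset Set.inter_subset_right
    fun v hv => (hT.mem_iff_of_mem_ancestors hv).2 hrT).antisymm fun v hv => ?_
  by_cases hc : v ∈ γ.core
  · exact .inl ⟨hc, hv⟩
  · obtain ⟨r', hr', hvr'⟩ : ∃ r', γ r' = none ∧ v ∈ γ.ancestors r' := by simpa [core] using hc
    have hr'_mem : r' ∈ γ.rootsIn T :=
      mem_rootsIn.2 ⟨hr', (hT.mem_iff_of_mem_ancestors hvr').1 hv⟩
    rw [h, Finset.mem_singleton] at hr'_mem
    exact .inr (hr'_mem ▸ hvr')

open Classical in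
theorem sum_isSaturated_rootsIn_eq_singleton {M : Type*} [AddCommMonoid M] (hr : γ r = none)
    (F : Set V → M) :
    ∑ T : Set V with γ.IsSaturated T ∧ γ.rootsIn T = {r}, F T =
      ∑ S : Set γ.core with (γ.restrict γ.core).IsSaturated S,
        F (Subtype.val '' S ∪ γ.ancestors r) := by
  symm
  refine Finset.sum_nbij' (fun S => Subtype.val '' S ∪ γ.ancestors r)
    (fun T => Subtype.val ⁻¹' T) ?_ ?_ ?_ ?_ fun _ _ => rfl <;>
    simp only [Finset.mem_filter, Finset.mem_univ, true_and]
  · exact fun S hS => ⟨(γ.isSaturated_core.image_val hS).union (isSaturated_ancestors hr),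
      rootsIn_union_ancestors hr (Subtype.coe_image_subset _ _)⟩
  · exact fun T hT => hT.1.preimage_val
  · intro S _
    ext v
    simp [Set.disjoint_left.1 (disjoint_core_ancestors hr) v.2]
  · rintro T ⟨hT, h⟩
    rw [Subtype.image_preimage_coe, core_inter_union_ancestors hT h]

open Classical in
theorem sum_roots_sum_isSaturated {M : Type*} [AddCommMonoid M] (γ : AromaticGraph V)
    (F : Set V → M) :
    ∑ r ∈ γ.roots, ∑ T : Set V with γ.IsSaturated T ∧ γ.rootsIn T = {r}, F T =
      ∑ T : Set V with γ.IsSaturated T ∧ (of (γ.restrict T)).numRoots = 1, F T := by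
  have hmaps : ∀ T ∈ ({T | γ.IsSaturated T ∧ (of (γ.restrict T)).numRoots = 1} : Finset (Set V)),
      γ.rootsIn T ∈ γ.roots.powersetCard 1 := fun T hT => by
    obtain ⟨hT, h⟩ := (Finset.mem_filter.1 hT).2
    exact Finset.mem_powersetCard.2 ⟨Finset.filter_subset _ _, numRoots_of_restrict hT ▸ h⟩
  rw [← Finset.sum_fiberwise_of_maps_to hmaps, Finset.powersetCard_one, Finset.sum_map]
  refine Finset.sum_congr rfl fun r _ => Finset.sum_congr ?_ fun _ _ => rfl
  ext T
  simp only [Finset.mem_filter, Finset.mem_univ, true_and, Function.Embedding.coeFn_mk, and_assoc]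
  refine and_congr_right fun hT => (and_iff_right_of_imp fun h => ?_).symm
  rw [numRoots_of_restrict hT, h, Finset.card_singleton]

end RootsIn

end AromaticGraph

/-! ### Uniqueness of the multiplicative extension -/

namespace IsMultiplicativeExtension

open AromaticGraph AromaticForest

variable {𝕜 : Type} [Field 𝕜] [CharZero 𝕜] {a : AromaticTree → 𝕜} {b : AromaticForest → 𝕜}

theorem apply_rootless (h : IsMultiplicativeExtension a b) {γ : AromaticForest}
    (hγ : γ.numRoots = 0) : b γ = (1 : FormalSeries AromaticForest 𝕜) γ :=
  (isAlgebraMorphism_inducedMap_iff.1 h.isAlgebraMorphism).1 ⟨γ, hγ⟩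

open Classical in
theorem apply_of_mul_mul {V : Type} [Finite V] [Fintype (Set V)]
    (h : IsMultiplicativeExtension a b) {γ : AromaticGraph V} {φ ψ : AromaticForest}
    (hγ : (of γ).numRoots = 0) (hφ : φ.IsLoopless) (hψ : ψ.IsLoopless) :
    b (of γ * (φ * ψ)) = ∑ S : Set V with γ.IsSaturated S,
      b (of (γ.restrict S) * φ) * b (of (γ.restrict Sᶜ) * ψ) := by
  have hσ : ((of γ).sigma : 𝕜) ≠ 0 := Nat.cast_ne_zero.2 (of γ).sigma_pos.ne'
  have hmul := (isAlgebraMorphism_inducedMap_iff.1 h.isAlgebraMorphism).2 ⟨φ, hφ⟩ ⟨ψ, hψ⟩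
    ⟨of γ, hγ⟩
  rw [normalized, div_eq_iff hσ, FormalSeries.mul_apply] at hmul
  rw [sum_isSaturated γ fun p q => b (p * φ) * b (q * ψ),
    mul_comm ((of γ).sigma : 𝕜)]
  simpa only [normalized, div_mul_div_comm] using hmul

open Classical in
theorem apply_of_eq_sum {V : Type} [Fintype V] (h : IsMultiplicativeExtension a b)
    {γ : AromaticGraph V} {r : V} (hr : γ r = none) :
    b (of γ) = ∑ T : Set V with γ.IsSaturated T ∧ γ.rootsIn T = {r},
      b (of (γ.restrict T)) * b (of (γ.restrict Tᶜ)) := by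
  have hcore : (of (γ.restrict γ.core)).numRoots = 0 := by
    rw [← rootlessPart_of, numRoots_rootlessPart]
  have hanc : (of (γ.restrict (γ.ancestors r))).IsLoopless :=
    (isLoopless_of _).2 (γ.loopless_restrict_compl_core.restrict_mono
      (disjoint_core_ancestors hr).subset_compl_left)
  have hother : (of (γ.restrict (γ.otherTrees r))).IsLoopless :=
    (isLoopless_of _).2 (γ.loopless_restrict_compl_core.restrict_mono
      (Set.compl_subset_compl.2 Set.subset_union_left))
  rw [of_eq_core_mul_ancestors_mul_otherTrees hr, h.apply_of_mul_mul hcore hanc hother,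
    sum_isSaturated_rootsIn_eq_singleton hr]
  refine Finset.sum_congr rfl fun S hS => ?_
  have hS := (Finset.mem_filter.1 hS).2
  rw [of_restrict_image_union_ancestors hr hS, of_restrict_compl_image_union_ancestors hr hS]

open Classical in
theorem numRoots_mul_apply_of {V : Type} [Fintype V] (h : IsMultiplicativeExtension a b)
    (γ : AromaticGraph V) :
    (of γ).numRoots * b (of γ) = ∑ T : Set V with γ.IsSaturated T,
      treeExtension a (of (γ.restrict T)) * b (of (γ.restrict Tᶜ)) := by
  have hb : ∀ T : Set V, (of (γ.restrict T)).numRoots = 1 →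
      b (of (γ.restrict T)) = treeExtension a (of (γ.restrict T)) := fun T hT =>
    (h.eq_on_trees ⟨_, hT⟩).trans (treeExtension_of_numRoots_eq_one a hT).symm
  calc (of γ).numRoots * b (of γ)
    _ = ∑ r ∈ γ.roots, ∑ T : Set V with γ.IsSaturated T ∧ γ.rootsIn T = {r},
          b (of (γ.restrict T)) * b (of (γ.restrict Tᶜ)) := by
        rw [numRoots_of, ← nsmul_eq_mul, ← Finset.sum_const]
        exact Finset.sum_congr rfl fun r hr => h.apply_of_eq_sum (Finset.mem_filter.1 hr).2
    _ = ∑ T : Set V with γ.IsSaturated T ∧ (of (γ.restrict T)).numRoots = 1,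
          treeExtension a (of (γ.restrict T)) * b (of (γ.restrict Tᶜ)) := by
        rw [sum_roots_sum_isSaturated γ fun T => b (of (γ.restrict T)) * b (of (γ.restrict Tᶜ))]
        exact Finset.sum_congr rfl fun T hT => by rw [hb T (Finset.mem_filter.1 hT).2.2]
    _ = ∑ T : Set V with γ.IsSaturated T,
          treeExtension a (of (γ.restrict T)) * b (of (γ.restrict Tᶜ)) := by
        rw [← Finset.filter_filter]
        refine Finset.sum_filter_of_ne fun T _ hT => by_contra fun h1 => hT ?_
        rw [treeExtension_of_numRoots_ne_one a h1, zero_mul]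

/-- If `E` multiplies every aromatic forest by its number of roots, then `E b = a b` for the
normalized series, with `a` extended by zero; that is, `b = exp a`. -/
theorem numRoots_mul_normalized (h : IsMultiplicativeExtension a b) (φ : AromaticForest) :
    φ.numRoots * normalized b φ = (normalized (treeExtension a) * normalized b) φ := by
  obtain ⟨n, γ, rfl⟩ := φ.exists_of
  have hσ : ((of γ).sigma : 𝕜) ≠ 0 := Nat.cast_ne_zero.2 (of γ).sigma_pos.ne'
  rw [normalized, ← mul_div_assoc, h.numRoots_mul_apply_of,
    sum_isSaturated γ fun p q => treeExtension a p * b q, mul_div_cancel_left₀ _ hσ,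
    FormalSeries.mul_apply]
  simp only [normalized, div_mul_div_comm]

theorem unique {b' : AromaticForest → 𝕜} (h : IsMultiplicativeExtension a b)
    (h' : IsMultiplicativeExtension a b') : b = b' := by
  suffices hnorm : ∀ φ, normalized b φ = normalized b' φ from
    funext fun φ => (div_left_inj' (Nat.cast_ne_zero.2 φ.sigma_pos.ne')).1 (hnorm φ)
  intro φ
  induction hk : φ.numRoots generalizing φ with
  | zero => rw [normalized, normalized, h.apply_rootless hk, h'.apply_rootless hk]
  | succ k ih =>
    refine mul_left_cancel₀ (Nat.cast_ne_zero.2 (hk ▸ k.succ_ne_zero : φ.numRoots ≠ 0)) ?_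
    rw [h.numRoots_mul_normalized, h'.numRoots_mul_normalized, FormalSeries.mul_apply,
      FormalSeries.mul_apply]
    refine Finset.sum_congr rfl fun p hp => ?_
    by_cases h1 : p.1.numRoots = 1
    · have hsum := numRoots_mul p.1 p.2
      rw [mem_mulAntidiagonal.1 hp, hk, h1] at hsum
      rw [ih p.2 (by omega)]
    · rw [normalized, treeExtension_of_numRoots_ne_one a h1, zero_div, zero_mul, zero_mul]

end IsMultiplicativeExtension

theorem existsUnique_isMultiplicativeExtension {𝕜 : Type} [Field 𝕜] [CharZero 𝕜]
    (a : AromaticTree → 𝕜) : ∃! b : AromaticForest → 𝕜, IsMultiplicativeExtension a b :=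
  ⟨multiplicativeExtension a, isMultiplicativeExtension_multiplicativeExtension a,
    fun _ h => h.unique (isMultiplicativeExtension_multiplicativeExtension a)⟩

/-! ### Elemental differential operators of products -/

section Directional

variable {𝕜 : Type} [RCLike 𝕜] {E X : Type*} [NormedAddCommGroup E] [NormedSpace 𝕜 E]
  [NormedAddCommGroup X] [NormedSpace 𝕜 X] {G : E → X}

variable (𝕜) in
/-- The derivative of `G` in the direction of the constant vector field `v`. -/
def dirDeriv (v : E) (G : E → X) (y : E) : X := fderiv 𝕜 G y v

theorem contDiff_dirDeriv (hG : ContDiff 𝕜 ∞ G) (v : E) : ContDiff 𝕜 ∞ (dirDeriv 𝕜 v G) :=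
  (contDiff_infty_iff_fderiv.1 hG).2.clm_apply contDiff_const

theorem contDiff_foldr_dirDeriv (hG : ContDiff 𝕜 ∞ G) (L : List E) :
    ContDiff 𝕜 ∞ (L.foldr (dirDeriv 𝕜) G) := by
  induction L with
  | nil => exact hG
  | cons v L ih => exact contDiff_dirDeriv ih v

theorem dirDeriv_dirDeriv (hG : ContDiff 𝕜 ∞ G) (v w : E) (y : E) :
    dirDeriv 𝕜 v (dirDeriv 𝕜 w G) y = fderiv 𝕜 (fderiv 𝕜 G) y v w := by
  have hd : DifferentiableAt 𝕜 (fderiv 𝕜 G) y :=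
    (contDiff_infty_iff_fderiv.1 (contDiff_infty_iff_fderiv.1 hG).2).1 y
  unfold dirDeriv
  simp [fderiv_clm_apply hd (differentiableAt_const w)]

theorem dirDeriv_comm (hG : ContDiff 𝕜 ∞ G) (v w : E) :
    dirDeriv 𝕜 v (dirDeriv 𝕜 w G) = dirDeriv 𝕜 w (dirDeriv 𝕜 v G) := by
  funext y
  have hsymm : IsSymmSndFDerivAt 𝕜 G y := hG.contDiffAt.isSymmSndFDerivAt <| by
    rw [minSmoothness_of_isRCLikeNormedField]
    exact WithTop.coe_le_coe.2 (le_top : (2 : ℕ∞) ≤ ⊤)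
  rw [dirDeriv_dirDeriv hG, dirDeriv_dirDeriv hG, hsymm]

theorem foldr_dirDeriv_eq_of_perm (hG : ContDiff 𝕜 ∞ G) {L L' : List E} (h : L.Perm L') :
    L.foldr (dirDeriv 𝕜) G = L'.foldr (dirDeriv 𝕜) G := by
  induction h with
  | nil => rfl
  | cons v _ ih => rw [List.foldr_cons, List.foldr_cons, ih]
  | swap v w L => exact dirDeriv_comm (contDiff_foldr_dirDeriv hG L) _ _
  | trans _ _ h₁ h₂ => exact h₁.trans h₂

theorem iteratedFDeriv_eq_foldr_dirDeriv (hG : ContDiff 𝕜 ∞ G) {k : ℕ} (m : Fin k → E) (y : E) :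
    iteratedFDeriv 𝕜 k G y m = (List.ofFn m).foldr (dirDeriv 𝕜) G y := by
  induction k generalizing y with
  | zero => rfl
  | succ k ih =>
    have hd : DifferentiableAt 𝕜 (iteratedFDeriv 𝕜 k G) y :=
      hG.differentiable_iteratedFDeriv (by exact_mod_cast ENat.natCast_lt_top _) y
    rw [hd.iteratedFDeriv_succ_apply_left', List.ofFn_succ, List.foldr_cons,
      funext (ih (Fin.tail m))]
    rfl

theorem iteratedFDeriv_comp_perm_of_contDiff (hG : ContDiff 𝕜 ∞ G) {k : ℕ} (m : Fin k → E)
    (σ : Equiv.Perm (Fin k)) (y : E) :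
    iteratedFDeriv 𝕜 k G y (m ∘ σ) = iteratedFDeriv 𝕜 k G y m := by
  rw [iteratedFDeriv_eq_foldr_dirDeriv hG, iteratedFDeriv_eq_foldr_dirDeriv hG,
    foldr_dirDeriv_eq_of_perm hG (Equiv.Perm.ofFn_comp_perm σ m)]

end Directional

section MultiPartial

variable {𝕜 : Type} [RCLike 𝕜] {d : ℕ} {X : Type*} [NormedAddCommGroup X] [NormedSpace 𝕜 X]
  {G : (Fin d → 𝕜) → X}

theorem multiPartial_eq_foldr_dirDeriv (hG : ContDiff 𝕜 ∞ G) (I : Multiset (Fin d))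
    (y : Fin d → 𝕜) :
    multiPartial I G y =
      (I.sort.map fun i => (Pi.single i 1 : Fin d → 𝕜)).foldr (dirDeriv 𝕜) G y := by
  rw [multiPartial, iteratedFDeriv_eq_foldr_dirDeriv hG]
  exact congrArg (fun L : List (Fin d → 𝕜) => L.foldr (dirDeriv 𝕜) G y)
    (List.ofFn_getElem_eq_map I.sort fun i => (Pi.single i 1 : Fin d → 𝕜))

theorem multiPartial_zero (G : (Fin d → 𝕜) → X) (y : Fin d → 𝕜) : multiPartial 0 G y = G y := by
  rw [multiPartial, Multiset.sort_zero]
  rfl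

theorem multiPartial_cons (hG : ContDiff 𝕜 ∞ G) (i : Fin d) (I : Multiset (Fin d))
    (y : Fin d → 𝕜) :
    multiPartial (i ::ₘ I) G y = multiPartial I (fderiv 𝕜 G) y (Pi.single i 1) := by
  have hperm : (i ::ₘ I).sort.Perm (I.sort ++ [i]) := by
    rw [← Multiset.coe_eq_coe, Multiset.sort_eq, ← Multiset.coe_add, Multiset.sort_eq,
      Multiset.coe_singleton, add_comm, Multiset.singleton_add]
  calc multiPartial (i ::ₘ I) G y
    _ = multiPartial I (dirDeriv 𝕜 (Pi.single i 1) G) y := by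
        rw [multiPartial_eq_foldr_dirDeriv hG, foldr_dirDeriv_eq_of_perm hG (hperm.map _),
          List.map_append, List.foldr_append,
          multiPartial_eq_foldr_dirDeriv (contDiff_dirDeriv hG _)]
        rfl
    _ = multiPartial I (fderiv 𝕜 G) y (Pi.single i 1) :=
        congrArg (fun M => M fun j => Pi.single (I.sort.get j) 1)
          ((ContinuousLinearMap.apply 𝕜 X (Pi.single i 1 : Fin d → 𝕜)).iteratedFDeriv_comp_left
            (contDiff_infty_iff_fderiv.1 hG).2.contDiffAt (by exact_mod_cast le_top))

theorem multiPartial_singleton_coord (i c : Fin d) (y : Fin d → 𝕜) :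
    multiPartial {i} (fun x : Fin d → 𝕜 => x c) y = (Pi.single i 1 : Fin d → 𝕜) c := by
  rw [← Multiset.cons_zero, multiPartial_cons (contDiff_apply 𝕜 𝕜 c), multiPartial_zero]
  exact congrArg (· (Pi.single i 1))
    (ContinuousLinearMap.proj (R := 𝕜) (φ := fun _ : Fin d => 𝕜) c).fderiv

end MultiPartial

section ElementalOp

variable {𝕜 : Type} [RCLike 𝕜] {d : ℕ} {X : Type*} [NormedAddCommGroup X] [NormedSpace 𝕜 X]

namespace AromaticGraph

variable {V W : Type} [Fintype V] [Fintype W]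

theorem map_roots_disjointUnion {ι : Type*} (γ : AromaticGraph V) (δ : AromaticGraph W)
    (i : V ⊕ W → ι) :
    (γ.disjointUnion δ).roots.val.map i =
      γ.roots.val.map (i ∘ Sum.inl) + δ.roots.val.map (i ∘ Sum.inr) := by
  rw [roots_disjointUnion, Finset.val_disjSum, Multiset.disjSum, Multiset.map_add,
    Multiset.map_map, Multiset.map_map]

variable [DecidableEq V] [DecidableEq W]

theorem mem_predecessors {γ : AromaticGraph V} {p q : V} :
    q ∈ γ.predecessors p ↔ γ.Edge q p := by
  simp [predecessors, Edge]

theorem predecessors_disjointUnion_inl (γ : AromaticGraph V) (δ : AromaticGraph W) (p : V) :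
    (γ.disjointUnion δ).predecessors (.inl p) =
      (γ.predecessors p).map Function.Embedding.inl := by
  ext (v | v) <;> simp [mem_predecessors, edge_disjointUnion]

theorem predecessors_disjointUnion_inr (γ : AromaticGraph V) (δ : AromaticGraph W) (p : W) :
    (γ.disjointUnion δ).predecessors (.inr p) =
      (δ.predecessors p).map Function.Embedding.inr := by
  ext (v | v) <;> simp [mem_predecessors, edge_disjointUnion]

/-- The product `∏ p, f^{i_p}_{I_{π(p)}}` of partial derivatives of `f` at `y` in the elemental
differential operator of `γ`, for an assignment `i` of coordinate indices to the nodes. -/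
def elementalWeight (γ : AromaticGraph V) (f : (Fin d → 𝕜) → (Fin d → 𝕜)) (y : Fin d → 𝕜)
    (i : V → Fin d) : 𝕜 :=
  ∏ p : V, multiPartial ((γ.predecessors p).val.map i) (fun x => f x (i p)) y

theorem elementalOp_eq_sum (γ : AromaticGraph V) (f : (Fin d → 𝕜) → (Fin d → 𝕜))
    (G : (Fin d → 𝕜) → X) (y : Fin d → 𝕜) :
    γ.elementalOp f G y =
      ∑ i, γ.elementalWeight f y i • multiPartial (γ.roots.val.map i) G y := rfl

theorem elementalWeight_disjointUnion (γ : AromaticGraph V) (δ : AromaticGraph W)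
    (f : (Fin d → 𝕜) → (Fin d → 𝕜)) (y : Fin d → 𝕜) (i : V ⊕ W → Fin d) :
    (γ.disjointUnion δ).elementalWeight f y i =
      γ.elementalWeight f y (i ∘ Sum.inl) * δ.elementalWeight f y (i ∘ Sum.inr) := by
  simp only [elementalWeight, Fintype.prod_sum_type, predecessors_disjointUnion_inl,
    predecessors_disjointUnion_inr, Finset.map_val, Multiset.map_map]
  rfl

end AromaticGraph

open AromaticGraph AromaticForest

theorem elementalField_of {V : Type} [Fintype V] [DecidableEq V] {γ : AromaticGraph V} {r : V}
    (hr : γ.roots = {r}) (hγ : (of γ).numRoots = 1) (f : (Fin d → 𝕜) → (Fin d → 𝕜))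
    (y : Fin d → 𝕜) :
    elementalField ⟨of γ, hγ⟩ f y =
      ∑ i, γ.elementalWeight f y i • (Pi.single (i r) 1 : Fin d → 𝕜) := by
  funext c
  simp only [elementalField, elementalOp_of, elementalOp_eq_sum, hr, Finset.singleton_val,
    Multiset.map_singleton, multiPartial_singleton_coord, Finset.sum_apply, Pi.smul_apply]

namespace AromaticForest

theorem elementalOp_one (f : (Fin d → 𝕜) → (Fin d → 𝕜)) (G : (Fin d → 𝕜) → X)
    (y : Fin d → 𝕜) : (1 : AromaticForest).elementalOp f G y = G y := by
  rw [← of_eq_one (Fin.elim0 : AromaticGraph (Fin 0)), elementalOp_of, elementalOp_eq_sum,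
    Fintype.sum_unique, elementalWeight, Fintype.prod_empty, one_smul]
  exact multiPartial_zero G y

theorem elementalOp_tree_mul (τ : AromaticTree) (ψ : AromaticForest)
    (f : (Fin d → 𝕜) → (Fin d → 𝕜)) {G : (Fin d → 𝕜) → X} (hG : ContDiff 𝕜 ∞ G)
    (y : Fin d → 𝕜) :
    (τ.1 * ψ).elementalOp f G y = ψ.elementalOp f (fderiv 𝕜 G) y (elementalField τ f y) := by
  obtain ⟨τ, hτ⟩ := τ
  obtain ⟨m, γ, rfl⟩ := τ.exists_of
  obtain ⟨n, δ, rfl⟩ := ψ.exists_of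
  obtain ⟨r, hr⟩ := Finset.card_eq_one.1 ((numRoots_of γ).symm.trans hτ)
  rw [elementalField_of hr, of_mul_of, elementalOp_of, elementalOp_of, elementalOp_eq_sum,
    elementalOp_eq_sum, sum_apply, ← (Equiv.sumArrowEquivProdArrow _ _ _).symm.sum_comp,
    Fintype.sum_prod_type_right]
  refine Finset.sum_congr rfl fun j _ => (Finset.sum_congr rfl fun i _ => ?_).trans
    (map_sum _ _ _).symm
  rw [elementalWeight_disjointUnion, map_roots_disjointUnion, hr, Finset.singleton_val,
    Multiset.map_singleton, Multiset.singleton_add, multiPartial_cons hG, map_smul, smul_apply,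
    smul_smul]
  rfl

end AromaticForest

end ElementalOp

open Finset.HasAntidiagonal (antidiagonal mem_antidiagonal)

/-! ### Formal substitution into multilinear maps -/

theorem sum_antidiagonalTuple_succ {M : Type*} [AddCommMonoid M] (k n : ℕ)
    (F : (Fin (k + 1) → ℕ) → M) :
    ∑ m ∈ Finset.Nat.antidiagonalTuple (k + 1) n, F m =
      ∑ p ∈ antidiagonal n, ∑ m ∈ Finset.Nat.antidiagonalTuple k p.2, F (Fin.snoc m p.1) := by
  rw [Finset.sum_sigma']
  refine Finset.sum_nbij' (fun m => ⟨(m (Fin.last k), ∑ j, Fin.init m j), Fin.init m⟩)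
    (fun x => Fin.snoc x.2 x.1.1) ?_ ?_ ?_ ?_ ?_
  · intro m hm
    rw [Finset.Nat.mem_antidiagonalTuple, Fin.sum_univ_castSucc, add_comm] at hm
    simpa [Finset.Nat.mem_antidiagonalTuple, Fin.init] using hm
  · rintro ⟨⟨n₁, n₂⟩, m⟩ hm
    simp only [Finset.mem_sigma, mem_antidiagonal, Finset.Nat.mem_antidiagonalTuple] at hm
    simp [Finset.Nat.mem_antidiagonalTuple, Fin.sum_univ_castSucc, hm.2, ← hm.1, add_comm]
  · exact fun m _ => Fin.snoc_init_self m
  · rintro ⟨⟨n₁, n₂⟩, m⟩ hm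
    simp only [Finset.mem_sigma, Finset.Nat.mem_antidiagonalTuple] at hm
    simp [hm.2]
  · exact fun m _ => by rw [Fin.snoc_init_self]

section MultilinearCoeff

variable {𝕜 E X : Type*} [NontriviallyNormedField 𝕜] [NormedAddCommGroup E] [NormedSpace 𝕜 E]
  [NormedAddCommGroup X] [NormedSpace 𝕜 X]

/-- The coefficient of `h ^ n` in `M(R, …, R)`, for a multilinear map `M` and the formal power
series `R = ∑ h ^ m c_m`. -/
def multilinearCoeff {k : ℕ} (M : E [×k]→L[𝕜] X) (c : ℕ → E) (n : ℕ) : X :=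
  ∑ m ∈ Finset.Nat.antidiagonalTuple k n, M fun j => c (m j)

theorem multilinearCoeff_zero (M : E [×0]→L[𝕜] X) (c : ℕ → E) (n : ℕ) :
    multilinearCoeff M c n = if n = 0 then M 0 else 0 := by
  rw [multilinearCoeff]
  cases n with
  | zero =>
    rw [Finset.Nat.antidiagonalTuple_zero_zero, Finset.sum_singleton, if_pos rfl]
    exact congrArg M (Subsingleton.elim _ _)
  | succ n =>
    rw [Finset.Nat.antidiagonalTuple_zero_succ, Finset.sum_empty, if_neg n.succ_ne_zero]

theorem multilinearCoeff_succ {k : ℕ} (M : E [×(k + 1)]→L[𝕜] X) (c : ℕ → E) (n : ℕ) :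
    multilinearCoeff M c n =
      ∑ p ∈ antidiagonal n, multilinearCoeff M.curryRight c p.2 (c p.1) := by
  rw [multilinearCoeff, sum_antidiagonalTuple_succ]
  refine Finset.sum_congr rfl fun p _ => ?_
  rw [multilinearCoeff, sum_apply]
  refine Finset.sum_congr rfl fun m _ => ?_
  rw [ContinuousMultilinearMap.curryRight_apply]
  congr 1
  funext j
  induction j using Fin.lastCases <;> simp

theorem multilinearCoeff_eq_zero {k : ℕ} (M : E [×k]→L[𝕜] X) {c : ℕ → E} (hc : c 0 = 0) {n : ℕ}
    (hn : n < k) : multilinearCoeff M c n = 0 := by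
  refine Finset.sum_eq_zero fun m hm => ?_
  rw [Finset.Nat.mem_antidiagonalTuple] at hm
  obtain ⟨j, hj⟩ : ∃ j, m j = 0 := by
    by_contra! h
    have hk : ∑ _j : Fin k, 1 ≤ ∑ j, m j :=
      Finset.sum_le_sum fun j _ => Nat.one_le_iff_ne_zero.2 (h j)
    rw [Fin.sum_const, smul_eq_mul, mul_one, hm] at hk
    exact hk.not_gt hn
  exact M.map_coord_zero j (by rw [hj, hc])

theorem curryRight_iteratedFDeriv (k : ℕ) (G : E → X) (y : E) :
    (iteratedFDeriv 𝕜 (k + 1) G y).curryRight = iteratedFDeriv 𝕜 k (fderiv 𝕜 G) y := by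
  ext m v
  rw [ContinuousMultilinearMap.curryRight_apply, iteratedFDeriv_succ_apply_right,
    Fin.init_snoc, Fin.snoc_last]

end MultilinearCoeff

section FormalComp

variable {𝕜 : Type} [RCLike 𝕜] {d : ℕ} {X : Type*} [NormedAddCommGroup X] [NormedSpace 𝕜 X]

theorem formalComp_eq_sum (G : (Fin d → 𝕜) → X) {Y c : ℕ → Fin d → 𝕜} (hc0 : c 0 = 0)
    (hc : ∀ n ≠ 0, c n = Y n) {n N : ℕ} (hn : n ≤ N) :
    formalComp 𝕜 G Y n = ∑ k ∈ Finset.range (N + 1),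
      (k.factorial : 𝕜)⁻¹ • multilinearCoeff (iteratedFDeriv 𝕜 k G (Y 0)) c n := by
  rw [formalComp, ← Finset.sum_subset (Finset.range_subset_range.2 (Nat.succ_le_succ hn))]
  · refine Finset.sum_congr rfl fun k _ => congrArg _ ?_
    rw [multilinearCoeff, Finset.sum_filter]
    refine Finset.sum_congr rfl fun m _ => ?_
    split_ifs with h
    · exact congrArg _ (funext fun j => (hc _ (h j)).symm)
    · push Not at h
      obtain ⟨j, hj⟩ := h
      exact ((iteratedFDeriv 𝕜 k G (Y 0)).map_coord_zero j (by rw [hj, hc0])).symm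
  · intro k _ hk
    rw [multilinearCoeff_eq_zero _ hc0 (by simpa using hk), smul_zero]

end FormalComp

/-! ### The parts of an S-series with a given number of roots -/

namespace AromaticForest

theorem sum_ofSize_sum_mulAntidiagonal {M : Type*} [AddCommMonoid M] (n : ℕ)
    (F : AromaticForest → AromaticForest → M) :
    ∑ φ ∈ ofSize n, ∑ p ∈ mulAntidiagonal φ, F p.1 p.2 =
      ∑ q ∈ antidiagonal n, ∑ φ ∈ ofSize q.1, ∑ ψ ∈ ofSize q.2, F φ ψ := by
  simp only [← Finset.sum_product']
  rw [Finset.sum_sigma', Finset.sum_sigma']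
  refine Finset.sum_nbij' (fun x => ⟨(x.2.1.size, x.2.2.size), x.2⟩)
    (fun x => ⟨x.2.1 * x.2.2, x.2⟩) ?_ ?_ ?_ ?_ fun _ _ => rfl
  · rintro ⟨φ, p⟩ hx
    simp only [Finset.mem_sigma, mem_ofSize, mem_mulAntidiagonal] at hx
    simp [mem_ofSize, ← size_mul, hx.1, hx.2]
  · rintro ⟨q, p⟩ hx
    simp only [Finset.mem_sigma, mem_antidiagonal, Finset.mem_product, mem_ofSize] at hx
    simp [mem_ofSize, mem_mulAntidiagonal, size_mul, hx.1, hx.2.1, hx.2.2]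
  · rintro ⟨φ, p⟩ hx
    simp only [Finset.mem_sigma, mem_mulAntidiagonal] at hx
    simp [hx.2]
  · rintro ⟨⟨n₁, n₂⟩, p⟩ hx
    simp only [Finset.mem_sigma, Finset.mem_product, mem_ofSize] at hx
    simp [hx.2.1, hx.2.2]

end AromaticForest

section SSeries

open AromaticForest

/-- The function that agrees with `b` on the aromatic forests with `k` roots and vanishes on the
others. -/
def homogeneousPart {𝕜 : Type*} [Zero 𝕜] (k : ℕ) (b : AromaticForest → 𝕜) (φ : AromaticForest) :
    𝕜 :=
  if φ.numRoots = k then b φ else 0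

theorem IsMultiplicativeExtension.homogeneousPart_zero {𝕜 : Type} [Field 𝕜] [CharZero 𝕜]
    {a : AromaticTree → 𝕜} {b : AromaticForest → 𝕜} (h : IsMultiplicativeExtension a b) :
    homogeneousPart 0 b = (1 : FormalSeries AromaticForest 𝕜) := by
  funext φ
  rw [homogeneousPart]
  split_ifs with hφ
  · exact h.apply_rootless hφ
  · rw [FormalSeries.one_apply, if_neg]
    rintro rfl
    exact hφ numRoots_one

theorem IsMultiplicativeExtension.succ_mul_normalized_homogeneousPart {𝕜 : Type} [Field 𝕜]
    [CharZero 𝕜] {a : AromaticTree → 𝕜} {b : AromaticForest → 𝕜}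
    (h : IsMultiplicativeExtension a b) (k : ℕ) (φ : AromaticForest) :
    ((k + 1 : ℕ) : 𝕜) * normalized (homogeneousPart (k + 1) b) φ =
      (normalized (treeExtension a) * normalized (homogeneousPart k b)) φ := by
  rw [FormalSeries.mul_apply]
  by_cases hφ : φ.numRoots = k + 1
  · have hb : normalized (homogeneousPart (k + 1) b) φ = normalized b φ := by
      rw [normalized, homogeneousPart, if_pos hφ, normalized]
    rw [hb, ← hφ, h.numRoots_mul_normalized, FormalSeries.mul_apply]
    refine Finset.sum_congr rfl fun p hp => ?_
    rw [← mem_mulAntidiagonal.1 hp, numRoots_mul] at hφ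
    by_cases h1 : p.1.numRoots = 1
    · rw [normalized, normalized, normalized, homogeneousPart, if_pos (by omega)]
    · rw [normalized, treeExtension_of_numRoots_ne_one a h1, zero_div, zero_mul, zero_mul]
  · rw [normalized, homogeneousPart, if_neg hφ, zero_div, mul_zero]
    refine (Finset.sum_eq_zero fun p hp => ?_).symm
    rw [← mem_mulAntidiagonal.1 hp, numRoots_mul] at hφ
    by_cases h1 : p.1.numRoots = 1
    · rw [normalized, normalized, homogeneousPart, if_neg (by omega), zero_div, mul_zero]
    · rw [normalized, treeExtension_of_numRoots_ne_one a h1, zero_div, zero_mul]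

variable {𝕜 : Type} [RCLike 𝕜] {d : ℕ} {X : Type*} [NormedAddCommGroup X] [NormedSpace 𝕜 X]

theorem sSeries_eq_sum_homogeneousPart (f : (Fin d → 𝕜) → (Fin d → 𝕜)) (b : AromaticForest → 𝕜)
    (G : (Fin d → 𝕜) → X) (y : Fin d → 𝕜) (n : ℕ) :
    sSeries f b G y n =
      ∑ k ∈ Finset.range (n + 1), sSeries f (homogeneousPart k b) G y n := by
  simp only [sSeries]
  rw [Finset.sum_comm]
  refine Finset.sum_congr rfl fun φ hφ => ?_
  have hk : φ.numRoots ∈ Finset.range (n + 1) :=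
    Finset.mem_range_succ_iff.2 (φ.numRoots_le_size.trans_eq (mem_ofSize.1 hφ))
  rw [Finset.sum_eq_single_of_mem _ hk fun k _ hne => by
    rw [homogeneousPart, if_neg hne.symm, zero_div, zero_smul], homogeneousPart, if_pos rfl]

theorem sSeries_one (f : (Fin d → 𝕜) → (Fin d → 𝕜)) (G : (Fin d → 𝕜) → X) (y : Fin d → 𝕜)
    (n : ℕ) :
    sSeries f (1 : FormalSeries AromaticForest 𝕜) G y n = if n = 0 then G y else 0 := by
  have hone : ∀ φ ∈ ofSize n, φ ≠ 1 →
      ((1 : FormalSeries AromaticForest 𝕜) φ / (φ.sigma : 𝕜)) • φ.elementalOp f G y = 0 :=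
    fun φ _ hφ => by rw [FormalSeries.one_apply, if_neg hφ, zero_div, zero_smul]
  split_ifs with hn
  · refine (Finset.sum_eq_single_of_mem 1 (mem_ofSize.2 hn.symm) hone).trans ?_
    rw [FormalSeries.one_apply, if_pos rfl, sigma_one, Nat.cast_one, div_one, one_smul,
      elementalOp_one]
  · refine Finset.sum_eq_zero fun φ hφ => hone φ hφ ?_
    rintro rfl
    exact hn (mem_ofSize.1 hφ).symm

theorem sum_treeExtension_mul_smul_elementalOp (a : AromaticTree → 𝕜) (b : AromaticForest → 𝕜)
    (f : (Fin d → 𝕜) → (Fin d → 𝕜)) {G : (Fin d → 𝕜) → X} (hG : ContDiff 𝕜 ∞ G)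
    (y : Fin d → 𝕜) (m n : ℕ) :
    ∑ φ ∈ ofSize m, ∑ ψ ∈ ofSize n, (normalized (treeExtension a) φ * normalized b ψ) •
        (φ * ψ).elementalOp f G y =
      sSeries f b (fderiv 𝕜 G) y n (bSeries f a y m) := by
  have hzero : ∀ φ ∈ ofSize m, ∑ ψ ∈ ofSize n, (normalized (treeExtension a) φ *
      normalized b ψ) • (φ * ψ).elementalOp f G y ≠ 0 → φ.numRoots = 1 := fun φ _ => by
    refine not_imp_comm.1 fun h1 => Finset.sum_eq_zero fun ψ _ => ?_
    rw [normalized, treeExtension_of_numRoots_ne_one a h1, zero_div, zero_mul, zero_smul]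
  rw [← Finset.sum_filter_of_ne hzero, ← Finset.sum_subtype_eq_sum_filter, bSeries, map_sum]
  refine Finset.sum_congr rfl fun τ _ => ?_
  rw [sSeries, sum_apply]
  refine Finset.sum_congr rfl fun ψ _ => ?_
  rw [elementalOp_tree_mul τ ψ f hG, smul_apply, map_smul, smul_smul, normalized, normalized,
    treeExtension_of_numRoots_eq_one a τ.2, mul_comm]

theorem sum_normalized_mul_smul_elementalOp (a : AromaticTree → 𝕜) (b : AromaticForest → 𝕜)
    (f : (Fin d → 𝕜) → (Fin d → 𝕜)) {G : (Fin d → 𝕜) → X} (hG : ContDiff 𝕜 ∞ G)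
    (y : Fin d → 𝕜) (n : ℕ) :
    ∑ φ ∈ ofSize n, (normalized (treeExtension a) * normalized b) φ • φ.elementalOp f G y =
      ∑ q ∈ antidiagonal n, sSeries f b (fderiv 𝕜 G) y q.2 (bSeries f a y q.1) := by
  simp only [← sum_treeExtension_mul_smul_elementalOp a b f hG]
  rw [← sum_ofSize_sum_mulAntidiagonal n fun φ ψ =>
    (normalized (treeExtension a) φ * normalized b ψ) • (φ * ψ).elementalOp f G y]
  refine Finset.sum_congr rfl fun φ _ => ?_
  rw [FormalSeries.mul_apply, Finset.sum_smul]
  exact Finset.sum_congr rfl fun p hp => by rw [mem_mulAntidiagonal.1 hp]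

theorem bSeries_zero (f : (Fin d → 𝕜) → (Fin d → 𝕜)) (a : AromaticTree → 𝕜) (y : Fin d → 𝕜) :
    bSeries f a y 0 = 0 := by
  refine Finset.sum_eq_zero fun τ hτ => ?_
  have hsize : τ.1.size = 0 := mem_ofSize.1 (Finset.mem_subtype.1 hτ)
  exact absurd (τ.2.symm.trans_le (τ.1.numRoots_le_size.trans_eq hsize)) (by decide)

namespace IsMultiplicativeExtension

variable {a : AromaticTree → 𝕜} {b : AromaticForest → 𝕜}

theorem succ_smul_sSeries_homogeneousPart (h : IsMultiplicativeExtension a b)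
    (f : (Fin d → 𝕜) → (Fin d → 𝕜)) {G : (Fin d → 𝕜) → X} (hG : ContDiff 𝕜 ∞ G)
    (y : Fin d → 𝕜) (k n : ℕ) :
    ((k + 1 : ℕ) : 𝕜) • sSeries f (homogeneousPart (k + 1) b) G y n =
      ∑ q ∈ antidiagonal n,
        sSeries f (homogeneousPart k b) (fderiv 𝕜 G) y q.2 (bSeries f a y q.1) := by
  rw [← sum_normalized_mul_smul_elementalOp a _ f hG, sSeries, Finset.smul_sum]
  refine Finset.sum_congr rfl fun φ _ => ?_
  rw [smul_smul, ← h.succ_mul_normalized_homogeneousPart, normalized]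

theorem factorial_smul_sSeries_homogeneousPart (h : IsMultiplicativeExtension a b)
    (f : (Fin d → 𝕜) → (Fin d → 𝕜)) {G : (Fin d → 𝕜) → X} (hG : ContDiff 𝕜 ∞ G)
    (y : Fin d → 𝕜) (k n : ℕ) :
    (k.factorial : 𝕜) • sSeries f (homogeneousPart k b) G y n =
      multilinearCoeff (iteratedFDeriv 𝕜 k G y) (bSeries f a y) n := by
  induction k generalizing X n with
  | zero =>
    rw [h.homogeneousPart_zero, sSeries_one, multilinearCoeff_zero, Nat.factorial_zero,
      Nat.cast_one, one_smul, iteratedFDeriv_zero_apply]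
  | succ k ih =>
    rw [multilinearCoeff_succ, Nat.factorial_succ, mul_comm, Nat.cast_mul, mul_smul,
      h.succ_smul_sSeries_homogeneousPart f hG, Finset.smul_sum, curryRight_iteratedFDeriv]
    refine Finset.sum_congr rfl fun q _ => ?_
    rw [← ih (contDiff_infty_iff_fderiv.1 hG).2, smul_apply]

theorem formalComp_eq_sSeries (h : IsMultiplicativeExtension a b)
    (f : (Fin d → 𝕜) → (Fin d → 𝕜)) {G : (Fin d → 𝕜) → X} (hG : ContDiff 𝕜 ∞ G)
    (y : Fin d → 𝕜) : formalComp 𝕜 G (shiftedBSeries f a y) = sSeries f b G y := by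
  funext n
  have h0 : shiftedBSeries f a y 0 = y := by
    rw [shiftedBSeries, bSeries_zero, if_pos rfl, add_zero]
  rw [sSeries_eq_sum_homogeneousPart, formalComp_eq_sum G (bSeries_zero f a y)
    (fun n hn => by rw [shiftedBSeries, if_neg hn, zero_add]) le_rfl, h0]
  refine Finset.sum_congr rfl fun k _ => ?_
  rw [← h.factorial_smul_sSeries_homogeneousPart f hG,
    inv_smul_smul₀ (Nat.cast_ne_zero.2 k.factorial_ne_zero)]

end IsMultiplicativeExtension

end SSeries

section Expansion

variable {𝕜 : Type} [RCLike 𝕜] {X : Type*} [NormedAddCommGroup X] [NormedSpace 𝕜 X]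

/-! ### Taylor's theorem -/

section Taylor

variable {E : Type} [NormedAddCommGroup E] [NormedSpace 𝕜 E]

theorem iteratedFDeriv_update_const {G : E → X} (hG : ContDiff 𝕜 ∞ G) {k : ℕ} (y u v : E)
    (i : Fin (k + 1)) :
    iteratedFDeriv 𝕜 (k + 1) G y (Function.update (fun _ => u) i v) =
      iteratedFDeriv 𝕜 k (fderiv 𝕜 G) y (fun _ => u) v := by
  rw [← curryRight_iteratedFDeriv, ContinuousMultilinearMap.curryRight_apply,
    ← iteratedFDeriv_comp_perm_of_contDiff hG _ (Equiv.swap i (Fin.last k))]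
  congr 1
  funext j
  simp only [Function.comp_apply, Function.update_apply]
  induction j using Fin.lastCases with
  | last => simp only [Equiv.swap_apply_right, if_true, Fin.snoc_last]
  | cast j =>
    rw [Fin.snoc_castSucc, if_neg]
    rw [Equiv.swap_apply_eq_iff, Equiv.swap_apply_left]
    exact (Fin.castSucc_lt_last j).ne

theorem hasFDerivAt_iteratedFDeriv_sub_const {G : E → X} (hG : ContDiff 𝕜 ∞ G) (k : ℕ)
    (y x : E) :
    HasFDerivAt (fun x => iteratedFDeriv 𝕜 (k + 1) G y fun _ => x - y)
      (((k + 1 : ℕ) : 𝕜) • iteratedFDeriv 𝕜 k (fderiv 𝕜 G) y fun _ => x - y) x := by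
  have hsub : ∀ _ : Fin (k + 1), HasFDerivAt (fun x => x - y) (ContinuousLinearMap.id 𝕜 E) x :=
    fun _ => (hasFDerivAt_id x).sub_const y
  refine (HasFDerivAt.multilinear_comp (f := iteratedFDeriv 𝕜 (k + 1) G y) hsub).congr_fderiv ?_
  ext v
  rw [sum_apply, smul_apply]
  refine (Finset.sum_congr rfl fun i _ => iteratedFDeriv_update_const hG y (x - y) v i).trans ?_
  rw [Finset.sum_const, Finset.card_univ, Fintype.card_fin, Nat.cast_smul_eq_nsmul]

theorem isBigO_pow_succ_of_hasFDerivAt {R : E → X} {R' : E → E →L[𝕜] X} {y : E} {n : ℕ}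
    (hR : ∀ x, HasFDerivAt R (R' x) x) (h0 : R y = 0)
    (hO : R' =O[𝓝 y] fun x => ‖x - y‖ ^ n) : R =O[𝓝 y] fun x => ‖x - y‖ ^ (n + 1) := by
  let : NormedSpace ℝ E := NormedSpace.restrictScalars ℝ 𝕜 E
  obtain ⟨C, hC, hbound⟩ := hO.exists_nonneg
  obtain ⟨ε, hε, hball⟩ := Metric.eventually_nhds_iff_ball.1 hbound.bound
  refine IsBigO.of_bound C (Metric.eventually_nhds_iff_ball.2 ⟨ε, hε, fun x hx => ?_⟩)
  rw [mem_ball_iff_norm] at hx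
  have hR' : ∀ z ∈ Metric.closedBall y ‖x - y‖, ‖R' z‖ ≤ C * ‖x - y‖ ^ n := fun z hz => by
    rw [mem_closedBall_iff_norm] at hz
    calc ‖R' z‖ ≤ C * ‖‖z - y‖ ^ n‖ := hball z (mem_ball_iff_norm.2 (hz.trans_lt hx))
      _ = C * ‖z - y‖ ^ n := by rw [norm_pow, norm_norm]
      _ ≤ C * ‖x - y‖ ^ n := by gcongr
  have hmean := (convex_closedBall y ‖x - y‖).norm_image_sub_le_of_norm_hasFDerivWithin_le
    (fun z _ => (hR z).hasFDerivWithinAt) hR' (Metric.mem_closedBall_self (norm_nonneg _))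
    (mem_closedBall_iff_norm.2 le_rfl)
  rwa [h0, sub_zero, mul_assoc, ← pow_succ, ← norm_norm (x - y), ← norm_pow] at hmean

-- The mean value inequality is used instead of the integral remainder of
-- `map_add_eq_sum_add_integral_iteratedFDeriv` because `X` may be incomplete.
theorem isBigO_sub_taylor_of_contDiff {G : E → X} (hG : ContDiff 𝕜 ∞ G) (y : E) (N : ℕ) :
    (fun x => G x - ∑ k ∈ Finset.range (N + 1),
      (k.factorial : 𝕜)⁻¹ • iteratedFDeriv 𝕜 k G y fun _ => x - y) =O[𝓝 y]
      fun x => ‖x - y‖ ^ (N + 1) := by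
  have hdiff : Differentiable 𝕜 G := (contDiff_infty_iff_fderiv.1 hG).1
  induction N generalizing X with
  | zero => simpa using (hdiff y).isBigO_sub.norm_right
  | succ N ih =>
    have hG' := (contDiff_infty_iff_fderiv.1 hG).2
    refine isBigO_pow_succ_of_hasFDerivAt (fun x => (hdiff x).hasFDerivAt.sub ?_) ?_
      (ih hG' (contDiff_infty_iff_fderiv.1 hG').1)
    · simp only [Finset.sum_range_succ' _ (N + 1), iteratedFDeriv_zero_apply]
      refine HasFDerivAt.add_const _ (HasFDerivAt.fun_sum fun k _ => ?_)
      refine ((hasFDerivAt_iteratedFDeriv_sub_const hG k y x).const_smul _).congr_fderiv ?_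
      rw [smul_smul, Nat.factorial_succ, Nat.cast_mul, mul_inv, mul_right_comm,
        inv_mul_cancel₀ (Nat.cast_ne_zero.2 k.succ_ne_zero), one_mul]
    · rw [Finset.sum_range_succ', Finset.sum_eq_zero fun k _ => by
        rw [ContinuousMultilinearMap.map_coord_zero _ 0 (sub_self y), smul_zero]]
      simp

end Taylor

/-! ### Asymptotic expansions -/

theorem isBigO_pow_smul_const {m n : ℕ} (hmn : m ≤ n) (x : X) :
    (fun h : 𝕜 => h ^ n • x) =O[𝓝 0] fun h : 𝕜 => h ^ m := by
  have hpow : (fun h : 𝕜 => h ^ n) =O[𝓝 0] fun h : 𝕜 => h ^ m := by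
    obtain rfl | hlt := hmn.eq_or_lt
    · exact isBigO_refl _ _
    · exact (isLittleO_pow_pow hlt).isBigO
  simpa using hpow.smul (isBigO_const_const x (one_ne_zero (α := 𝕜)) (𝓝 (0 : 𝕜)))

theorem sum_range_sum_antidiagonal {M : Type*} [AddCommMonoid M] (N : ℕ) (F : ℕ × ℕ → M) :
    ∑ n ∈ Finset.range (N + 1), ∑ p ∈ antidiagonal n, F p =
      ∑ p ∈ Finset.range (N + 1) ×ˢ Finset.range (N + 1) with p.1 + p.2 ≤ N, F p := by
  rw [← Finset.sum_fiberwise_of_maps_to (t := Finset.range (N + 1))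
    (g := fun p : ℕ × ℕ => p.1 + p.2) fun p hp =>
      Finset.mem_range_succ_iff.2 (Finset.mem_filter.1 hp).2]
  refine Finset.sum_congr rfl fun n hn => Finset.sum_congr ?_ fun _ _ => rfl
  ext p
  simp only [mem_antidiagonal, Finset.mem_filter, Finset.mem_product, Finset.mem_range] at hn ⊢
  omega

theorem sum_smul_clm_apply_sum_smul {Z : Type*} [NormedAddCommGroup Z] [NormedSpace 𝕜 Z]
    (a : ℕ → Z →L[𝕜] X) (b : ℕ → Z) (s : Finset ℕ) (h : 𝕜) :
    (∑ n ∈ s, h ^ n • a n) (∑ n ∈ s, h ^ n • b n) =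
      ∑ p ∈ s ×ˢ s, h ^ (p.1 + p.2) • a p.2 (b p.1) := by
  rw [map_sum, Finset.sum_product]
  refine Finset.sum_congr rfl fun i _ => ?_
  rw [sum_apply]
  refine Finset.sum_congr rfl fun j _ => ?_
  rw [smul_apply, map_smul, smul_smul, ← pow_add, add_comm]

namespace HasExpansionUpTo

variable {N : ℕ} {u : 𝕜 → X} {c : ℕ → X}

theorem congr_coeff {c' : ℕ → X} (hu : HasExpansionUpTo 𝕜 u c N) (hc : ∀ n ≤ N, c n = c' n) :
    HasExpansionUpTo 𝕜 u c' N := by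
  refine hu.congr_left fun h => congrArg _ (Finset.sum_congr rfl fun n hn => ?_)
  rw [hc n (Finset.mem_range_succ_iff.1 hn)]

theorem const (x : X) : HasExpansionUpTo 𝕜 (fun _ => x) (fun n => if n = 0 then x else 0) N := by
  refine (isBigO_zero _ _).congr_left fun h => ?_
  simp

theorem sum {ι : Type*} {s : Finset ι} {u : ι → 𝕜 → X} {c : ι → ℕ → X}
    (hu : ∀ i ∈ s, HasExpansionUpTo 𝕜 (u i) (c i) N) :
    HasExpansionUpTo 𝕜 (fun h => ∑ i ∈ s, u i h) (fun n => ∑ i ∈ s, c i n) N := by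
  refine (IsBigO.sum hu).congr_left fun h => ?_
  simp only [Finset.sum_apply, Finset.smul_sum]
  rw [Finset.sum_sub_distrib, Finset.sum_comm]

theorem const_smul (hu : HasExpansionUpTo 𝕜 u c N) (r : 𝕜) :
    HasExpansionUpTo 𝕜 (fun h => r • u h) (fun n => r • c n) N := by
  refine (IsBigO.const_smul_left hu r).congr_left fun h => ?_
  rw [Pi.smul_apply, smul_sub, Finset.smul_sum]
  exact congrArg _ (Finset.sum_congr rfl fun n _ => smul_comm _ _ _)

theorem of_sub_isBigO {v : 𝕜 → X} (hu : HasExpansionUpTo 𝕜 u c N)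
    (hv : (fun h => v h - u h) =O[𝓝 0] fun h : 𝕜 => h ^ (N + 1)) : HasExpansionUpTo 𝕜 v c N :=
  (hv.add hu).congr_left fun _ => sub_add_sub_cancel _ _ _

theorem isBigO_pow {m : ℕ} (hu : HasExpansionUpTo 𝕜 u c N) (hm : m ≤ N + 1)
    (hc : ∀ n < m, c n = 0) : u =O[𝓝 0] fun h : 𝕜 => h ^ m := by
  have hterm : ∀ n ∈ Finset.range (N + 1), (fun h : 𝕜 => h ^ n • c n) =O[𝓝 0] fun h => h ^ m := by
    intro n _
    obtain hn | hn := lt_or_ge n m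
    · simpa only [hc n hn, smul_zero] using isBigO_zero _ _
    · exact isBigO_pow_smul_const hn (c n)
  have hrem : (fun h : 𝕜 => h ^ (N + 1)) =O[𝓝 0] fun h : 𝕜 => h ^ m := by
    simpa only [smul_eq_mul, mul_one] using isBigO_pow_smul_const (𝕜 := 𝕜) hm (1 : 𝕜)
  exact ((hu.trans hrem).add (IsBigO.fun_sum hterm)).congr_left fun _ => sub_add_cancel _ _

theorem clm_apply {Z : Type*} [NormedAddCommGroup Z] [NormedSpace 𝕜 Z] {u : 𝕜 → Z →L[𝕜] X}
    {a : ℕ → Z →L[𝕜] X} {r : 𝕜 → Z} {b : ℕ → Z} (hu : HasExpansionUpTo 𝕜 u a N)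
    (hr : HasExpansionUpTo 𝕜 r b N) :
    HasExpansionUpTo 𝕜 (fun h => u h (r h))
      (fun n => ∑ p ∈ antidiagonal n, a p.2 (b p.1)) N := by
  set s := Finset.range (N + 1)
  have hr_one : r =O[𝓝 0] fun h : 𝕜 => h ^ 0 := hr.isBigO_pow (Nat.zero_le _) (by simp)
  have ha_one : (fun h : 𝕜 => ∑ n ∈ s, h ^ n • a n) =O[𝓝 0] fun h => h ^ 0 :=
    IsBigO.fun_sum fun n _ => isBigO_pow_smul_const n.zero_le (a n)
  have hleft : (fun h => (u h - ∑ n ∈ s, h ^ n • a n) (r h)) =O[𝓝 0] fun h => h ^ (N + 1) := by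
    simpa only [pow_zero, mul_one] using
      (isBoundedBilinearMap_apply (𝕜 := 𝕜)).isBigO_comp.trans (hu.norm_left.mul hr_one.norm_left)
  have hright : (fun h => (∑ n ∈ s, h ^ n • a n) (r h - ∑ n ∈ s, h ^ n • b n)) =O[𝓝 0]
      fun h => h ^ (N + 1) := by
    simpa only [pow_zero, one_mul] using
      (isBoundedBilinearMap_apply (𝕜 := 𝕜)).isBigO_comp.trans (ha_one.norm_left.mul hr.norm_left)
  have hhigh : (fun h : 𝕜 => ∑ p ∈ s ×ˢ s with ¬ p.1 + p.2 ≤ N, h ^ (p.1 + p.2) • a p.2 (b p.1))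
      =O[𝓝 0] fun h => h ^ (N + 1) :=
    IsBigO.fun_sum fun p hp => isBigO_pow_smul_const (not_le.1 (Finset.mem_filter.1 hp).2) _
  have hlow : ∀ h : 𝕜, ∑ n ∈ s, h ^ n • ∑ p ∈ antidiagonal n, a p.2 (b p.1) =
      ∑ p ∈ s ×ˢ s with p.1 + p.2 ≤ N, h ^ (p.1 + p.2) • a p.2 (b p.1) := fun h => by
    rw [← sum_range_sum_antidiagonal]
    refine Finset.sum_congr rfl fun n _ => Finset.smul_sum.trans ?_
    exact Finset.sum_congr rfl fun p hp => by rw [mem_antidiagonal.1 hp]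
  refine ((hleft.add hright).add hhigh).congr_left fun h => ?_
  rw [hlow, map_sub, sum_smul_clm_apply_sum_smul, sub_apply,
    ← Finset.sum_filter_add_sum_filter_not (s ×ˢ s) fun p => p.1 + p.2 ≤ N]
  abel

theorem multilinear {E : Type} [NormedAddCommGroup E] [NormedSpace 𝕜 E] {r : 𝕜 → E} {c : ℕ → E}
    (hr : HasExpansionUpTo 𝕜 r c N) {k : ℕ} (M : E [×k]→L[𝕜] X) :
    HasExpansionUpTo 𝕜 (fun h => M fun _ => r h) (multilinearCoeff M c) N := by
  induction k generalizing X with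
  | zero =>
    have hM : (fun h => M fun _ => r h) = fun _ => M 0 :=
      funext fun h => congrArg M (Subsingleton.elim _ _)
    rw [hM]
    exact (const (M 0)).congr_coeff fun n _ => (multilinearCoeff_zero M c n).symm
  | succ k ih =>
    have hM : (fun h => M fun _ => r h) = fun h => M.curryRight (fun _ => r h) (r h) := by
      funext h
      rw [ContinuousMultilinearMap.curryRight_apply]
      congr 1
      funext j
      induction j using Fin.lastCases <;> simp
    rw [hM]
    exact ((ih M.curryRight).clm_apply hr).congr_coeff fun n _ => (multilinearCoeff_succ M c n).symm

theorem comp_contDiff {d : ℕ} {G : (Fin d → 𝕜) → X} (hG : ContDiff 𝕜 ∞ G)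
    {Y : 𝕜 → Fin d → 𝕜} {c : ℕ → Fin d → 𝕜} (hY : HasExpansionUpTo 𝕜 Y c N) :
    HasExpansionUpTo 𝕜 (fun h => G (Y h)) (formalComp 𝕜 G c) N := by
  set r : ℕ → Fin d → 𝕜 := fun n => if n = 0 then 0 else c n with hr
  have hR : HasExpansionUpTo 𝕜 (fun h => Y h - c 0) r N := by
    refine hY.congr_left fun h => ?_
    simp only [hr, Finset.sum_range_succ', Nat.succ_ne_zero, if_false, if_true, pow_zero, one_smul,
      add_zero]
    abel
  have hRid : (fun h => Y h - c 0) =O[𝓝 0] fun h : 𝕜 => h := by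
    simpa only [pow_one] using hR.isBigO_pow (Nat.le_add_left 1 N) fun n hn =>
      if_pos (Nat.lt_one_iff.1 hn)
  have hlim : Tendsto Y (𝓝 0) (𝓝 (c 0)) :=
    tendsto_sub_nhds_zero_iff.1 (hRid.trans_tendsto tendsto_id)
  have htaylor := (isBigO_sub_taylor_of_contDiff hG (c 0) N).comp_tendsto hlim
  refine of_sub_isBigO ?_ (htaylor.trans (hRid.norm_left.pow (N + 1)))
  refine (sum fun k _ =>
    (hR.multilinear (iteratedFDeriv 𝕜 k G (c 0))).const_smul (k.factorial : 𝕜)⁻¹).congr_coeff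
    fun n hn => ?_
  exact (formalComp_eq_sum G (if_pos rfl) (fun n hn => if_neg hn) hn).symm

end HasExpansionUpTo

end Expansion

end

theorem theorem4p2 {𝕜 : Type} [RCLike 𝕜] (a : AromaticTree → 𝕜) :
    (∃! abar : AromaticForest → 𝕜, IsMultiplicativeExtension a abar) ∧
    ∀ abar : AromaticForest → 𝕜, IsMultiplicativeExtension a abar →
      ∀ {d : ℕ} {W : Type*} [NormedAddCommGroup W] [NormedSpace 𝕜 W]
        (f : (Fin d → 𝕜) → (Fin d → 𝕜)) (G : (Fin d → 𝕜) → W),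
        ContDiff 𝕜 ∞ f → ContDiff 𝕜 ∞ G → ∀ y : Fin d → 𝕜,
          formalComp 𝕜 G (shiftedBSeries f a y) = sSeries f abar G y ∧
          ∀ (N : ℕ) (Y : 𝕜 → Fin d → 𝕜),
            HasExpansionUpTo 𝕜 Y (shiftedBSeries f a y) N →
              HasExpansionUpTo 𝕜 (fun h => G (Y h)) (sSeries f abar G y) N := by
  refine ⟨existsUnique_isMultiplicativeExtension a, ?_⟩
  intro abar habar d W _ _ f G _ hG y
  have hformal := habar.formalComp_eq_sSeries f hG y
  exact ⟨hformal, fun N Y hY => hformal ▸ hY.comp_contDiff hG⟩
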